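/- Let $\mathbb{F}_q$ be a finite field with $q$ elements, $K$ an algebraically closed field containing $\mathbb{F}_q$, $A=\mathbb{F}_q[T]$, and $\delta:A\to K$ a morphism of $\mathbb{F}_q$-algebras. Let $\Lambda_n$ be the $K$-span of the polynomials $X_i^{q^j}$ ($1\le i\le n$, $j\ge 0$) in $K[X_1,\dots,X_n]$, and for $f\in\Lambda_n$ let $d(f)$ be its linear part, viewed as a linear form on $K^n$. A $q$-variety $F\subset K^n$ is the set of common zeros of a subset of $\Lambda_n$; it is an $\mathbb{F}_q$-subspace of $K^n$. Its tangent space is $T(F)=\{x\in K^n : d(f)(x)=0 \text{ for all } f\in\Lambda_n \text{ vanishing on } F\}$. Let $\mathrm{End}(F)$ be the $\mathbb{F}_q$-algebra (under composition) of maps $\psi:F\to F$ of the form $\psi=(f_1,\dots,f_n)|_F$ with $f_i\in\Lambda_n$; the differential $d(\psi):T(F)\to T(F)$, $x\mapsto(d(f_1)(x),\dots,d(f_n)(x))$, does not depend on the choice of the $f_i$. An $A$-module $(F,\Phi)$ is a $q$-variety $F$ with a morphism of $\mathbb{F}_q$-algebras $\Phi:A\to\mathrm{End}(F)$, $a\mapsto\Phi_a$,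 such that $d(\Phi_a)=\delta(a)\,\mathrm{Id}_{T(F)}$ for all $a\in A$. Let $K\{F\}$ be the $K$-vector space of functions $F\to K$ that are restrictions of elements of $\Lambda_n$; it is a $K[T]$-module with $T\cdot f=f\circ\Phi_T$. Let $(F,\Phi)$ be an $A$-module. Then $K(F):=K(T)\otimes_{K[T]}K\{F\}$ has finite dimension $r(F)$ over $K(T)$, and there exists $c\in A\setminus\{0\}$ such that for all $a\in A$ prime to $c$, $$\mathrm{Tor}(a,F):=\{x\in F : \Phi_a(x)=0\}\cong (A/aA)^{r(F)}$$ as $A$-modules, where $b\in A$ acts on $\mathrm{Tor}(a,F)$ by $\Phi_b$. -/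

import Mathlib

open Polynomial TensorProduct

noncomputable section

namespace QVar

section Additive

variable (k K : Type*) [Field k] [Fintype k] [Field K] [Algebra k K]

/-- The `𝔽_q`-linear polynomials in `n` variables: the `K`-span of the monomials `X_i ^ (q ^ j)`,
where `k = 𝔽_q` has `q` elements. -/
def Lam (n : ℕ) : Submodule K (MvPolynomial (Fin n) K) :=
  Submodule.span K
    {f | ∃ (i : Fin n) (j : ℕ), f = MvPolynomial.X i ^ (Fintype.card k ^ j)}

variable {k K}

theorem pow_eq_frob {R : Type*} [CommRing R] [Algebra k R] (j : ℕ) (x : R) :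
    x ^ (Fintype.card k ^ j) = ((FiniteField.frobeniusAlgHom k R) ^ j) x := by
  induction j with
  | zero => simp
  | succ j ih => rw [pow_succ, pow_mul, ih, pow_succ', AlgHom.mul_apply,
      FiniteField.coe_frobeniusAlgHom]

theorem Lam.eval_add {n : ℕ} {f : MvPolynomial (Fin n) K} (hf : f ∈ Lam k K n)
    (x y : Fin n → K) :
    MvPolynomial.eval (x + y) f = MvPolynomial.eval x f + MvPolynomial.eval y f := by
  induction hf using Submodule.span_induction with
  | mem f h =>
    obtain ⟨i, j, rfl⟩ := h
    simp only [map_pow, MvPolynomial.eval_X, Pi.add_apply]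
    simp only [pow_eq_frob, map_add]
  | zero => simp
  | add f g _ _ hf hg => simp only [map_add, hf, hg]; ring
  | smul a f _ hf => simp only [MvPolynomial.smul_eval, hf]; ring

theorem Lam.eval_smul {n : ℕ} {f : MvPolynomial (Fin n) K} (hf : f ∈ Lam k K n)
    (c : k) (x : Fin n → K) :
    MvPolynomial.eval (c • x) f = c • MvPolynomial.eval x f := by
  induction hf using Submodule.span_induction with
  | mem f h =>
    obtain ⟨i, j, rfl⟩ := h
    simp only [map_pow, MvPolynomial.eval_X, Pi.smul_apply]
    simp only [pow_eq_frob, map_smul]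
  | zero => simp
  | add f g _ _ hf hg => simp only [map_add, hf, hg, smul_add]
  | smul a f _ hf => simp only [MvPolynomial.smul_eval, hf, mul_smul_comm]

theorem Lam.pow_mem {n : ℕ} {f : MvPolynomial (Fin n) K} (hf : f ∈ Lam k K n) (j : ℕ) :
    f ^ (Fintype.card k ^ j) ∈ Lam k K n := by
  induction hf using Submodule.span_induction with
  | mem f h =>
    obtain ⟨i, m, rfl⟩ := h
    rw [← pow_mul, ← pow_add]
    exact Submodule.subset_span ⟨i, m + j, rfl⟩
  | zero =>
    rw [pow_eq_frob, map_zero]; exact zero_mem _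
  | add f g _ _ hf hg =>
    rw [pow_eq_frob] at *
    rw [map_add]; exact add_mem hf hg
  | smul a f _ hf =>
    rw [_root_.smul_pow]; exact Submodule.smul_mem _ _ hf

theorem Lam.X_mem {n : ℕ} (i : Fin n) : (MvPolynomial.X i : MvPolynomial (Fin n) K) ∈ Lam k K n :=
  Submodule.subset_span ⟨i, 0, by simp⟩

/-- Composition of `𝔽_q`-linear polynomials is `𝔽_q`-linear. -/
theorem Lam.bind_mem {m n : ℕ} {g : MvPolynomial (Fin m) K} (hg : g ∈ Lam k K m)
    {f : Fin m → MvPolynomial (Fin n) K} (hf : ∀ i, f i ∈ Lam k K n) :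
    MvPolynomial.bind₁ f g ∈ Lam k K n := by
  induction hg using Submodule.span_induction with
  | mem g h =>
    obtain ⟨i, j, rfl⟩ := h
    rw [map_pow, MvPolynomial.bind₁_X_right]
    exact Lam.pow_mem (hf i) j
  | zero => rw [map_zero]; exact zero_mem _
  | add g h _ _ hg hh => rw [map_add]; exact add_mem hg hh
  | smul a g _ hg => rw [map_smul]; exact Submodule.smul_mem _ _ hg

theorem eval_bind {m n : ℕ} (g : MvPolynomial (Fin m) K) (f : Fin m → MvPolynomial (Fin n) K)
    (x : Fin n → K) :
    MvPolynomial.eval x (MvPolynomial.bind₁ f g) =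
      MvPolynomial.eval (fun i => MvPolynomial.eval x (f i)) g := by
  have := MvPolynomial.eval₂Hom_bind₁ (RingHom.id K) x f g
  exact this

/-- The linear part `d(f) = ∑ a_{0,i} X_i` of a polynomial, as a linear form on `K^n`. -/
def linPart {n : ℕ} : MvPolynomial (Fin n) K →ₗ[K] ((Fin n → K) →ₗ[K] K) where
  toFun f := ∑ i, MvPolynomial.coeff (Finsupp.single i 1) f • LinearMap.proj i
  map_add' f g := by simp [add_smul, Finset.sum_add_distrib]
  map_smul' a f := by simp [mul_smul, Finset.smul_sum]

theorem linPart_apply {n : ℕ} (f : MvPolynomial (Fin n) K) (x : Fin n → K) :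
    linPart f x = ∑ i, MvPolynomial.coeff (Finsupp.single i 1) f * x i := by
  simp [linPart]

theorem linPart_X {n : ℕ} (i : Fin n) (x : Fin n → K) :
    linPart (MvPolynomial.X i : MvPolynomial (Fin n) K) x = x i := by
  classical
  simp [linPart_apply, MvPolynomial.coeff_X, Finsupp.single_left_inj]

theorem linPart_X_pow {n : ℕ} (i : Fin n) (e : ℕ) (he : e ≠ 1) :
    linPart (MvPolynomial.X i ^ e : MvPolynomial (Fin n) K) = 0 := by
  classical
  ext x
  rw [LinearMap.comp_apply, linPart_apply]
  simp only [MvPolynomial.coeff_X_pow]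
  refine Finset.sum_eq_zero fun l _ => ?_
  rw [if_neg, zero_mul]
  intro h
  rcases (Finsupp.single_eq_single_iff _ _ _ _).1 h with h | h <;> omega

theorem linPart_pow {n : ℕ} {f : MvPolynomial (Fin n) K} (hf : f ∈ Lam k K n) (j : ℕ)
    (hj : j ≠ 0) : linPart (f ^ (Fintype.card k ^ j)) = 0 := by
  have hq : 1 < Fintype.card k := Fintype.one_lt_card
  induction hf using Submodule.span_induction with
  | mem f h =>
    obtain ⟨i, m, rfl⟩ := h
    rw [← pow_mul, ← pow_add]
    exact linPart_X_pow _ _ (Nat.one_lt_pow (by omega) hq).ne'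
  | zero => rw [pow_eq_frob, map_zero, map_zero]
  | add f g _ _ hf hg =>
    rw [pow_eq_frob] at *
    rw [map_add, map_add, hf, hg, add_zero]
  | smul a f _ hf => rw [_root_.smul_pow, map_smul, hf, smul_zero]

/-- The chain rule for linear parts. -/
theorem linPart_bind {m n : ℕ} {g : MvPolynomial (Fin m) K} (hg : g ∈ Lam k K m)
    {f : Fin m → MvPolynomial (Fin n) K} (hf : ∀ i, f i ∈ Lam k K n) (x : Fin n → K) :
    linPart (MvPolynomial.bind₁ f g) x = linPart g (fun i => linPart (f i) x) := by
  have hq : 1 < Fintype.card k := Fintype.one_lt_card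
  induction hg using Submodule.span_induction with
  | mem g h =>
    obtain ⟨i, j, rfl⟩ := h
    rw [map_pow, MvPolynomial.bind₁_X_right]
    rcases eq_or_ne j 0 with rfl | hj
    · simp [linPart_X]
    · rw [linPart_pow (hf i) j hj, linPart_X_pow _ _ (Nat.one_lt_pow hj hq).ne']
      rfl
  | zero => simp
  | add g h _ _ hg hh => simp only [map_add, LinearMap.add_apply, hg, hh]
  | smul a g _ hg => simp only [map_smul, LinearMap.smul_apply, hg]

/-- The zero set `Z(S)` of a set `S` of `𝔽_q`-linear polynomials; it is an `𝔽_q`-subspace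
of `K^n`. -/
def zeros {n : ℕ} (S : Set (Lam k K n)) : Submodule k (Fin n → K) where
  carrier := {x | ∀ f ∈ S, MvPolynomial.eval x (f : MvPolynomial (Fin n) K) = 0}
  add_mem' := fun {x y} hx hy f hf => by
    rw [Lam.eval_add f.2, hx f hf, hy f hf, add_zero]
  zero_mem' := fun f _ => by
    simpa using Lam.eval_smul f.2 (0 : k) 0
  smul_mem' := fun c x hx f hf => by
    rw [Lam.eval_smul f.2, hx f hf, smul_zero]

end Additive

/-- A `q`-variety in `K^n`: a subset of the form `Z(S)`. -/
structure QVariety (k K : Type*) [Field k] [Fintype k] [Field K] [Algebra k K] (n : ℕ) where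
  carrier : Submodule k (Fin n → K)
  exists_eq_zeros : ∃ S : Set (Lam k K n), carrier = zeros S

section Variety

variable {k K : Type*} [Field k] [Fintype k] [Field K] [Algebra k K] {n : ℕ}

/-- `M(F)`: the `𝔽_q`-linear polynomials vanishing on `F`. -/
def vanishing (F : QVariety k K n) : Set (MvPolynomial (Fin n) K) :=
  {f | f ∈ Lam k K n ∧ ∀ x ∈ F.carrier, MvPolynomial.eval x f = 0}

theorem mem_of_vanishing (F : QVariety k K n) {x : Fin n → K}
    (h : ∀ f ∈ vanishing F, MvPolynomial.eval x f = 0) : x ∈ F.carrier := by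
  obtain ⟨S, hS⟩ := F.exists_eq_zeros
  rw [hS]
  intro f hf
  refine h f ⟨f.2, fun y hy => ?_⟩
  rw [hS] at hy
  exact hy f hf

/-- The tangent space `T(F) ⊆ K^n`: the common kernel of the linear parts of the elements
of `M(F)`. -/
def tangent (F : QVariety k K n) : Submodule K (Fin n → K) where
  carrier := {x | ∀ f ∈ vanishing F, linPart f x = 0}
  add_mem' := fun hx hy f hf => by rw [map_add, hx f hf, hy f hf, add_zero]
  zero_mem' := fun f _ => map_zero _
  smul_mem' := fun c x hx f hf => by rw [map_smul, hx f hf, smul_zero]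

/-- `f = (f_1, …, f_n)` is a tuple of `𝔽_q`-linear polynomials inducing the self-map `ψ` of `F`. -/
def Represents (F : QVariety k K n) (ψ : F.carrier → F.carrier)
    (f : Fin n → MvPolynomial (Fin n) K) : Prop :=
  (∀ i, f i ∈ Lam k K n) ∧
    ∀ (x : F.carrier) (i : Fin n), (ψ x : Fin n → K) i = MvPolynomial.eval (x : Fin n → K) (f i)

/-- `End(F)`: the `𝔽_q`-algebra of self-maps of `F` given by `𝔽_q`-linear polynomials
(such maps are automatically `𝔽_q`-linear); the product is composition. -/
def QEnd (F : QVariety k K n) : Subalgebra k (Module.End k F.carrier) where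
  carrier := {ψ | ∃ f, Represents F ψ f}
  mul_mem' := by
    rintro ψ χ ⟨f, hf, hf'⟩ ⟨g, hg, hg'⟩
    refine ⟨fun i => MvPolynomial.bind₁ g (f i), fun i => Lam.bind_mem (hf i) hg, fun x i => ?_⟩
    rw [Module.End.mul_apply, hf', eval_bind, funext (hg' x)]
  add_mem' := by
    rintro ψ χ ⟨f, hf, hf'⟩ ⟨g, hg, hg'⟩
    exact ⟨fun i => f i + g i, fun i => add_mem (hf i) (hg i), fun x i => by
      simp [hf', hg']⟩
  algebraMap_mem' := fun c =>
    ⟨fun i => algebraMap k K c • MvPolynomial.X i,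
      fun i => Submodule.smul_mem _ _ (Lam.X_mem i), fun x i => by
      simp [Module.algebraMap_end_apply, Algebra.smul_def]⟩

theorem linPart_mem_tangent {F : QVariety k K n} {ψ : F.carrier → F.carrier}
    {f : Fin n → MvPolynomial (Fin n) K} (hf : Represents F ψ f) {x : Fin n → K}
    (hx : x ∈ tangent F) : (fun i => linPart (f i) x) ∈ tangent F := by
  intro g hg
  rw [← linPart_bind hg.1 hf.1]
  refine hx _ ⟨Lam.bind_mem hg.1 hf.1, fun y hy => ?_⟩
  have := hg.2 (ψ ⟨y, hy⟩) (ψ ⟨y, hy⟩).2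
  rwa [funext (hf.2 ⟨y, hy⟩), ← eval_bind] at this

/-- The differential `d(ψ) : T(F) → T(F)` of an endomorphism `ψ` of `F`:
`x ↦ (d(f_1)(x), …, d(f_n)(x))` for any tuple `f` of polynomials inducing `ψ`. -/
def differential {F : QVariety k K n} (ψ : QEnd F) : tangent F →ₗ[K] tangent F :=
  LinearMap.codRestrict (tangent F)
    ((LinearMap.pi fun i => linPart (ψ.2.choose i)).comp (tangent F).subtype)
    fun x => linPart_mem_tangent ψ.2.choose_spec x.2

/-- The differential does not depend on the chosen polynomials. -/
theorem differential_apply {F : QVariety k K n} (ψ : QEnd F)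
    {f : Fin n → MvPolynomial (Fin n) K} (hf : Represents F ψ.1 f) (x : tangent F) (i : Fin n) :
    (differential ψ x : Fin n → K) i = linPart (f i) (x : Fin n → K) := by
  have hg := ψ.2.choose_spec
  have h := x.2 (ψ.2.choose i - f i) ⟨sub_mem (hg.1 i) (hf.1 i), fun y hy => by
    rw [map_sub, ← hg.2 ⟨y, hy⟩ i, ← hf.2 ⟨y, hy⟩ i, sub_self]⟩
  rw [map_sub, LinearMap.sub_apply, sub_eq_zero] at h
  exact h

/-- `K{F} = Mor(F, K)`: the `K`-vector space of functions `F → K` given by `𝔽_q`-linear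
polynomials (such functions are automatically `𝔽_q`-linear). -/
def Fun (F : QVariety k K n) : Submodule K (F.carrier →ₗ[k] K) where
  carrier := {g | ∃ f ∈ Lam k K n, ∀ x : F.carrier, g x = MvPolynomial.eval (x : Fin n → K) f}
  add_mem' := by
    rintro g h ⟨f, hf, hf'⟩ ⟨f₂, hf₂, hf₂'⟩
    exact ⟨f + f₂, add_mem hf hf₂, fun x => by simp [hf', hf₂']⟩
  zero_mem' := ⟨0, zero_mem _, fun x => by simp⟩
  smul_mem' := by
    rintro c g ⟨f, hf, hf'⟩
    exact ⟨c • f, Submodule.smul_mem _ _ hf, fun x => by simp [hf']⟩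

/-- The `K`-linear map `f ↦ f ∘ ψ` on `K{F}`. -/
def pullback {F : QVariety k K n} (ψ : QEnd F) : Fun F →ₗ[K] Fun F where
  toFun g := ⟨g.1.comp ψ.1, by
    obtain ⟨f, hf, hf'⟩ := g.2
    obtain ⟨h, hh, hh'⟩ := ψ.2
    refine ⟨MvPolynomial.bind₁ h f, Lam.bind_mem hf hh, fun x => ?_⟩
    rw [LinearMap.comp_apply, hf', eval_bind, funext (hh' x)]⟩
  map_add' _ _ := rfl
  map_smul' _ _ := rfl

end Variety

/-- An `A`-module structure on the `q`-variety `F`, where `A = 𝔽_q[T]` and `δ : A → K`. -/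
structure AModule {k K : Type*} [Field k] [Fintype k] [Field K] [Algebra k K]
    (δ : k[X] →ₐ[k] K) {n : ℕ} (F : QVariety k K n) where
  toAlgHom : k[X] →ₐ[k] QEnd F
  differential_eq : ∀ a : k[X], differential (toAlgHom a) = δ a • LinearMap.id

namespace AModule

variable {k K : Type*} [Field k] [Fintype k] [Field K] [Algebra k K]
  {δ : k[X] →ₐ[k] K} {n : ℕ} {F : QVariety k K n}

/-- The points of `F`, with the action `a • x = Φ_a(x)` of `A`. -/
def Points (_Φ : AModule δ F) : Type _ := F.carrier

instance (Φ : AModule δ F) : AddCommGroup Φ.Points :=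
  inferInstanceAs (AddCommGroup F.carrier)

instance (Φ : AModule δ F) : Module k[X] Φ.Points where
  smul a x := (Φ.toAlgHom a : Module.End k F.carrier) x
  one_smul x := by
    change (Φ.toAlgHom 1 : Module.End k F.carrier) x = x
    rw [map_one]; rfl
  mul_smul a b x := by
    change (Φ.toAlgHom (a * b) : Module.End k F.carrier) x = _
    rw [map_mul]; rfl
  smul_zero a := map_zero (Φ.toAlgHom a : Module.End k F.carrier)
  smul_add a := map_add (Φ.toAlgHom a : Module.End k F.carrier)
  add_smul a b x := by
    change (Φ.toAlgHom (a + b) : Module.End k F.carrier) x = _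
    rw [map_add]; rfl
  zero_smul x := by
    change (Φ.toAlgHom 0 : Module.End k F.carrier) x = _
    rw [map_zero]; rfl

/-- `Tor(a, F) = {x ∈ F | Φ_a(x) = 0}`, as an `A`-module. -/
def Tor (Φ : AModule δ F) (a : k[X]) : Submodule k[X] Φ.Points :=
  Submodule.torsionBy k[X] Φ.Points a

theorem mem_Tor (Φ : AModule δ F) (a : k[X]) (x : F.carrier) :
    (show Φ.Points from x) ∈ Φ.Tor a ↔ (Φ.toAlgHom a : Module.End k F.carrier) x = 0 :=
  Iff.rfl

/-- `K{F}` as a `K[T]`-module: scalars of `K` act on values, and `T • f = f ∘ Φ_T`,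
so that `a • f = f ∘ Φ_a` for `a ∈ A`. -/
abbrev Motive (Φ : AModule δ F) : Type _ :=
  Module.AEval' (pullback (Φ.toAlgHom X))

theorem pullback_add (ψ χ : QEnd F) (f : Fun F) : pullback (ψ + χ) f = pullback ψ f + pullback χ f :=
  Subtype.ext (LinearMap.ext fun _ => map_add f.1 _ _)
theorem pullback_smul (c : k) (ψ : QEnd F) (f : Fun F) : pullback (c • ψ) f = algebraMap k K c • pullback ψ f := by
  refine Subtype.ext (LinearMap.ext fun x => ?_)
  have := map_smul f.1 c (ψ.1 x)
  rw [← algebraMap_smul K c (f.1 (ψ.1 x))] at this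
  exact this
theorem pullback_pow (ψ : QEnd F) (f : Fun F) (m : ℕ) : ((pullback ψ : Module.End K (Fun F)) ^ m) f = pullback (ψ ^ m) f := by
  induction m with
  | zero => rfl
  | succ m ih => rw [pow_succ', Module.End.mul_apply, ih, pow_succ]; rfl

/-- The action of `a ∈ A ⊆ K[T]` on `K{F}` is `f ↦ f ∘ Φ_a`. -/
theorem map_smul_of (Φ : AModule δ F) (a : k[X]) (f : Fun F) :
    (a.map (algebraMap k K)) • (Module.AEval'.of (pullback (Φ.toAlgHom X)) f : Φ.Motive) =
      Module.AEval'.of (pullback (Φ.toAlgHom X)) (pullback (Φ.toAlgHom a) f) := by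
  have key : ∀ φ : Module.End K (Fun F), φ = pullback (Φ.toAlgHom X) → 
     (a.map (algebraMap k K)) • (Module.AEval'.of φ f) = Module.AEval'.of φ (pullback (Φ.toAlgHom a) f) := by
    intro φ hφ
    induction a using Polynomial.induction_on' with
    | add a b ha hb =>
      rw [Polynomial.map_add, add_smul, ha, hb, ← map_add, ← pullback_add, map_add Φ.toAlgHom]
    | monomial m c =>
      rw [Polynomial.map_monomial, ← C_mul_X_pow_eq_monomial, ← C_mul_X_pow_eq_monomial, mul_smul]
      rw [Module.AEval'.X_pow_smul_of]
      rw [show (C c * X ^ m : k[X]) = c • X ^ m from (smul_eq_C_mul c).symm]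
      rw [map_smul Φ.toAlgHom, map_pow Φ.toAlgHom, pullback_smul, ← pullback_pow, ← hφ]
      rw [Module.AEval.C_smul]
      rfl
  exact key _ rfl

/-- `K(F) = K(T) ⊗_{K[T]} K{F}`. -/
abbrev RatMotive (Φ : AModule δ F) : Type _ :=
  RatFunc K ⊗[K[X]] Φ.Motive

/-- The rank `r(F) = dim_{K(T)} K(F)`. -/
def rank (Φ : AModule δ F) : ℕ :=
  Module.finrank (RatFunc K) Φ.RatMotive

end AModule

end QVar

end

/-!
The proof studies the motive `M = K{F}` as a `K[T]`-module with the operator `τ : g ↦ g ^ q`, which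
is semilinear over the twist `p ↦ p^(1)` of `K[T]` that raises coefficients to the power `q`.
Three properties of `(M, τ)` are used: `τ` is injective, `M` is generated over `K{τ}` by the `n`
coordinate functions, and `(T - δ(T)) M ⊆ τ M`, which is the condition on the differential of `Φ`
read on the cotangent space `M / τ M` (`restrict_mem_range_frobFun`,
`X_sub_C_smul_mem_range_frobMotive`).

*Finite rank.* `M` need not be finitely generated over `K[T]`. Since the part of `M` of `τ`-degree
less than `i` has dimension at most `n i`, a dimension count gives each generator `e` a nontrivial
relation `∑ p_b(T) τ ^ b e = 0` (`exists_relation`). If `p_d` is its leading coefficient, applying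
powers of `τ` shows that products of twists of `p_d` carry all `τ ^ l e` into the `K[T]`-span of
those with `l < d`. So, up to torsion by products of twists of finitely many polynomials, `M` is
finitely generated, and even free with a basis of `r(F)` elements.

*Choice of `c`.* A polynomial `a` over `𝔽_q` is equal to its twists, so if it is prime to some
`P ∈ K[T]`, it is prime to all twists of `P`. Only the roots of `P` that are algebraic over `𝔽_q`
can be roots of such an `a ≠ 0`; `c` is divisible by their minimal polynomials
(`exists_mem_coprimeSubmonoid`). With `P` the product of `T - δ(T)` and the polynomials above, every
`a` prime to `c` satisfies `M / aM ≅ (K[T] / a) ^ r(F)` (`nonempty_quotient_range_lsmul_equiv`), and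
`a(δ(T)) ≠ 0` makes `τ` injective on `M / aM` (`mem_range_lsmul_of_map_mem`).

*Counting points.* Points of `F` are the `K`-linear forms `φ` on `M` with `φ(τ m) = φ(m) ^ q`, and
`Tor(a, F)` consists of those that vanish on `aM` (`card_Tor`). By Lang's theorem `M / aM` has a
basis of `τ`-fixed vectors (`exists_span_fixed`), so there are `q ^ (r(F) deg a)` such forms.
Applied to all divisors of `a`, this count forces `Tor(a, F) ≅ (A / a) ^ r(F)`: for each prime
`p ∣ a` the quotient `Tor(a, F) / p` has `|A / p| ^ r(F)` elements, so `r(F)` elements generate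
`Tor(a, F)`, and the resulting surjection from `(A / a) ^ r(F)` is a bijection
(`nonempty_linearEquiv_pi_quotient`).
-/

open Polynomial TensorProduct

noncomputable section

/-! ### Finite modules over a principal ideal domain -/

section FiniteModules

variable {A : Type*} [CommRing A] {U : Type*} [AddCommGroup U] [Module A U]

/-- Multiplication by `p` on a finite module has kernel and cokernel of the same size. -/
theorem card_torsionBy_eq_card_quotient [Finite U] (p : A) :
    Nat.card (Submodule.torsionBy A U p) =
      Nat.card (U ⧸ LinearMap.range (LinearMap.lsmul A U p)) := by
  have h1 := Submodule.card_eq_card_quotient_mul_card (LinearMap.ker (LinearMap.lsmul A U p))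
  have h2 := Submodule.card_eq_card_quotient_mul_card (LinearMap.range (LinearMap.lsmul A U p))
  rw [Nat.card_congr (LinearMap.quotKerEquivRange (LinearMap.lsmul A U p)).toEquiv] at h1
  have h0 : 0 < Nat.card (LinearMap.range (LinearMap.lsmul A U p)) := Nat.card_pos
  have h3 := (mul_comm _ _).trans (h1.symm.trans (h2))
  exact Nat.eq_of_mul_eq_mul_left h0 h3

/-- By the Chinese remainder theorem, one element avoids all the proper submodules `pU`. -/
theorem exists_forall_notMem_range (S : Finset A)
    (hS : ∀ p ∈ S, ∀ p' ∈ S, p ≠ p' → IsCoprime p p') :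
    ∃ u : U, ∀ p ∈ S, LinearMap.range (LinearMap.lsmul A U p) ≠ ⊤ →
      u ∉ LinearMap.range (LinearMap.lsmul A U p) := by
  classical
  have hv : ∀ p : A, ∃ v : U, LinearMap.range (LinearMap.lsmul A U p) ≠ ⊤ →
      v ∉ LinearMap.range (LinearMap.lsmul A U p) := by
    intro p
    by_cases h : LinearMap.range (LinearMap.lsmul A U p) = ⊤
    · exact ⟨0, fun h' => (h' h).elim⟩
    · obtain ⟨v, hv⟩ := SetLike.exists_not_mem_of_ne_top _ h rfl
      exact ⟨v, fun _ => hv⟩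
  choose v hv using hv
  refine ⟨∑ p ∈ S, (∏ p' ∈ S.erase p, p') • v p, fun p hp hne hmem => hv p hne ?_⟩
  rw [← Finset.add_sum_erase S _ hp] at hmem
  have hrest : ∑ p' ∈ S.erase p, (∏ p'' ∈ S.erase p', p'') • v p' ∈
      LinearMap.range (LinearMap.lsmul A U p) := by
    refine Submodule.sum_mem _ fun p' hp' => ?_
    have hp'' := Finset.mem_erase.1 hp'
    obtain ⟨d, hd⟩ := Finset.dvd_prod_of_mem (fun x => x)
      (Finset.mem_erase.2 ⟨hp''.1.symm, hp⟩ : p ∈ S.erase p')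
    exact ⟨d • v p', by rw [hd, mul_smul]; rfl⟩
  have hmem' := (Submodule.add_mem_iff_left _ hrest).1 hmem
  have hco : IsCoprime (∏ p' ∈ S.erase p, p') p :=
    IsCoprime.prod_left fun p' hp' =>
      (hS p hp p' (Finset.mem_of_mem_erase hp') (Finset.ne_of_mem_erase hp').symm).symm
  obtain ⟨x, y, hxy⟩ := hco
  rw [← one_smul A (v p), ← hxy, add_smul]
  refine add_mem ?_ ⟨y • v p, ?_⟩
  · rw [mul_smul]; exact Submodule.smul_mem _ _ hmem'
  · rw [LinearMap.lsmul_apply, smul_smul, mul_comm]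

/-- Dividing out an element outside `pU` makes `U / pU` smaller by a factor of `|A / p|`. -/
theorem card_quotient_mul_le [Finite U] {p : A} (hp : (Ideal.span {p}).IsMaximal) {u : U}
    (hu : u ∉ LinearMap.range (LinearMap.lsmul A U p)) :
    Nat.card (A ⧸ Ideal.span {p}) * Nat.card ((U ⧸ Submodule.span A {u}) ⧸
      LinearMap.range (LinearMap.lsmul A (U ⧸ Submodule.span A {u}) p)) ≤
      Nat.card (U ⧸ LinearMap.range (LinearMap.lsmul A U p)) := by
  set R := LinearMap.range (LinearMap.lsmul A U p) with hR
  set R' := LinearMap.range (LinearMap.lsmul A (U ⧸ Submodule.span A {u}) p) with hR'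
  have hle : R ≤ R'.comap (Submodule.span A {u}).mkQ := by
    rintro _ ⟨v, rfl⟩
    exact ⟨(Submodule.span A {u}).mkQ v, rfl⟩
  set π : (U ⧸ R) →ₗ[A] ((U ⧸ Submodule.span A {u}) ⧸ R') := R.mapQ R' _ hle with hπ
  have hπs : Function.Surjective π := by
    intro y
    obtain ⟨y, rfl⟩ := Submodule.Quotient.mk_surjective _ y
    obtain ⟨y, rfl⟩ := Submodule.Quotient.mk_surjective _ y
    exact ⟨Submodule.Quotient.mk y, rfl⟩
  have : Finite (U ⧸ R) := Quotient.finite _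
  have hcard := Submodule.card_eq_card_quotient_mul_card (LinearMap.ker π)
  rw [Nat.card_congr (LinearMap.quotKerEquivOfSurjective π hπs).toEquiv] at hcard
  rw [hcard]
  refine Nat.mul_le_mul_right _ ?_
  -- `A / p` embeds into the kernel of `π` through the class of `u`
  have huker : R.mkQ u ∈ LinearMap.ker π := by
    rw [LinearMap.mem_ker, hπ, Submodule.mkQ_apply, Submodule.mapQ_apply, Submodule.mkQ_apply,
      (Submodule.Quotient.mk_eq_zero _).2 (Submodule.mem_span_singleton_self u)]
    exact Submodule.Quotient.mk_zero _
  have hker : Ideal.span {p} =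
      LinearMap.ker (LinearMap.toSpanSingleton A (LinearMap.ker π) ⟨R.mkQ u, huker⟩) := by
    refine hp.eq_of_le ?_ ?_
    · intro h
      have h1 := (Ideal.eq_top_iff_one _).1 h
      rw [LinearMap.mem_ker, LinearMap.toSpanSingleton_apply, one_smul] at h1
      exact hu ((Submodule.Quotient.mk_eq_zero _).1 (congrArg Subtype.val h1))
    · rw [Ideal.span_singleton_le_iff_mem, LinearMap.mem_ker, LinearMap.toSpanSingleton_apply]
      refine Subtype.ext ?_
      exact (Submodule.Quotient.mk_eq_zero _).2 ⟨u, rfl⟩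
  rw [hker]
  exact Nat.card_le_card_of_injective _
    (LinearMap.quotKerEquivRange _).injective |>.trans
      (Nat.card_le_card_of_injective _ Subtype.val_injective)

/-- Let a finite module `U` be killed by a product of elements `p` that generate maximal ideals.
If `|U / pU| ≤ |A / p| ^ r` for each of them, then `U` is generated by `r` elements. -/
theorem exists_span_range_eq_top (s : Multiset A)
    (hmax : ∀ p ∈ s, (Ideal.span {p}).IsMaximal)
    (hfin : ∀ p ∈ s, Finite (A ⧸ Ideal.span {p}))
    (hco : ∀ p ∈ s, ∀ p' ∈ s, p ≠ p' → IsCoprime p p') (r : ℕ) :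
    ∀ (U : Type*) [AddCommGroup U] [Module A U] [Finite U], (∀ u : U, s.prod • u = 0) →
      (∀ p ∈ s, Nat.card (U ⧸ LinearMap.range (LinearMap.lsmul A U p)) ≤
        Nat.card (A ⧸ Ideal.span {p}) ^ r) →
      ∃ u : Fin r → U, Submodule.span A (Set.range u) = ⊤ := by
  classical
  induction r with
  | zero =>
    intro U _ _ _ hs hU
    have hdiv : ∀ t : Multiset A, t ≤ s → ∀ u : U, ∃ v : U, t.prod • v = u := by
      intro t
      induction t using Multiset.induction_on with
      | empty => intro _ u; exact ⟨u, by simp⟩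
      | cons p t ih =>
        intro hle u
        have hps : p ∈ s := Multiset.mem_of_le hle (Multiset.mem_cons_self p t)
        have : Finite (U ⧸ LinearMap.range (LinearMap.lsmul A U p)) := Quotient.finite _
        have h1 := hU p hps
        rw [pow_zero] at h1
        have hsub := (Nat.card_eq_one_iff_unique.1 (le_antisymm h1 Nat.card_pos)).1
        have htop := Submodule.Quotient.subsingleton_iff.1 hsub
        obtain ⟨w, hw⟩ : u ∈ LinearMap.range (LinearMap.lsmul A U p) := htop ▸ Submodule.mem_top
        obtain ⟨v, hv⟩ := ih ((Multiset.le_cons_self t p).trans hle) w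
        exact ⟨v, by rw [Multiset.prod_cons, mul_smul, hv]; exact hw⟩
    refine ⟨Fin.elim0, eq_top_iff.2 fun u _ => ?_⟩
    obtain ⟨v, hv⟩ := hdiv s le_rfl u
    rw [← hv, hs]
    exact zero_mem _
  | succ r ih =>
    intro U _ _ _ hs hU
    obtain ⟨u, hu⟩ := exists_forall_notMem_range (U := U) s.toFinset fun p hp p' hp' =>
      hco p (Multiset.mem_toFinset.1 hp) p' (Multiset.mem_toFinset.1 hp')
    have : Finite (U ⧸ Submodule.span A {u}) := Quotient.finite _
    obtain ⟨w, hw⟩ := ih (U ⧸ Submodule.span A {u}) (fun x => by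
        obtain ⟨x, rfl⟩ := Submodule.Quotient.mk_surjective _ x
        rw [← Submodule.Quotient.mk_smul, hs, Submodule.Quotient.mk_zero]) (fun p hp => by
        have := hfin p hp
        have hpos : 0 < Nat.card (A ⧸ Ideal.span {p}) := Nat.card_pos
        by_cases htop : LinearMap.range (LinearMap.lsmul A U p) = ⊤
        · have htop' : LinearMap.range
              (LinearMap.lsmul A (U ⧸ Submodule.span A {u}) p) = ⊤ := by
            refine eq_top_iff.2 fun x _ => ?_
            obtain ⟨x, rfl⟩ := Submodule.Quotient.mk_surjective _ x
            obtain ⟨y, hy⟩ : x ∈ LinearMap.range (LinearMap.lsmul A U p) :=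
              htop ▸ Submodule.mem_top
            exact ⟨Submodule.Quotient.mk y, by rw [← hy]; rfl⟩
          have := Submodule.Quotient.subsingleton_iff.2 htop'
          rw [Nat.card_unique]
          exact Nat.one_le_pow _ _ hpos
        · have h1 := (card_quotient_mul_le (hmax p hp)
            (hu p (Multiset.mem_toFinset.2 hp) htop)).trans (hU p hp)
          rw [pow_succ'] at h1
          exact Nat.le_of_mul_le_mul_left h1 hpos)
    choose v hv using fun i => Submodule.Quotient.mk_surjective _ (w i)
    refine ⟨Fin.cons u v, ?_⟩
    rw [Fin.range_cons, Submodule.span_insert]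
    have hmap : (Submodule.span A (Set.range v)).map (Submodule.span A {u}).mkQ = ⊤ := by
      rw [Submodule.map_span, ← Set.range_comp, ← hw]
      congr 2
      exact funext hv
    rw [sup_comm]
    have := Submodule.comap_map_mkQ (Submodule.span A {u}) (Submodule.span A (Set.range v))
    rw [hmap, Submodule.comap_top] at this
    rw [sup_comm, ← this]

/-- A finite module killed by `a` is isomorphic to `(A / a) ^ r` if it has as many elements and,
for each `p ∣ a`, as many elements killed by `p`. -/
theorem nonempty_linearEquiv_pi_quotient [IsDomain A] [IsPrincipalIdealRing A]
    (hfin : ∀ b : A, b ≠ 0 → Finite (A ⧸ Ideal.span {b})) [Finite U] {a : A} (ha : a ≠ 0)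
    (hU : ∀ u : U, a • u = 0) (r : ℕ)
    (hprime : ∀ p : A, p ∣ a → Nat.card (Submodule.torsionBy A U p) =
      Nat.card (A ⧸ Ideal.span {p}) ^ r)
    (hcard : Nat.card U = Nat.card (A ⧸ Ideal.span {a}) ^ r) :
    Nonempty (U ≃ₗ[A] (Fin r → A ⧸ Ideal.span {a})) := by
  classical
  let _ : StrongNormalizationMonoid A := UniqueFactorizationMonoid.strongNormalizationMonoid
  set s := UniqueFactorizationMonoid.normalizedFactors a with hs
  have hirr : ∀ p ∈ s, Irreducible p := fun p hp =>
    UniqueFactorizationMonoid.irreducible_of_normalized_factor p hp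
  obtain ⟨u, hu⟩ := exists_span_range_eq_top s
    (fun p hp => PrincipalIdealRing.isMaximal_of_irreducible (hirr p hp))
    (fun p hp => hfin p (hirr p hp).ne_zero)
    (fun p hp p' hp' hne => by
      refine (hirr p hp).coprime_iff_not_dvd.2 fun hd => hne ?_
      refine dvd_antisymm_of_normalize_eq
        (UniqueFactorizationMonoid.normalize_normalized_factor p hp)
        (UniqueFactorizationMonoid.normalize_normalized_factor p' hp') hd
        ((hirr p hp).associated_of_dvd (hirr p' hp') hd).dvd') r U
    (fun x => by
      obtain ⟨e, he⟩ := UniqueFactorizationMonoid.prod_normalizedFactors ha |>.symm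
      rw [← hs] at he
      rw [← he, mul_comm, mul_smul, hU, smul_zero])
    (fun p hp => by
      rw [← card_torsionBy_eq_card_quotient,
        hprime p (UniqueFactorizationMonoid.dvd_of_mem_normalizedFactors hp)])
  have hfa := hfin a ha
  let φ : (Fin r → A ⧸ Ideal.span {a}) →ₗ[A] U :=
    LinearMap.lsum A (fun _ => A ⧸ Ideal.span {a}) A fun i =>
      (Ideal.span {a}).liftQ (LinearMap.toSpanSingleton A U (u i)) (by
        rw [Ideal.span_singleton_le_iff_mem, LinearMap.mem_ker, LinearMap.toSpanSingleton_apply,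
          hU])
  have hφ : Function.Surjective φ := by
    rw [← LinearMap.range_eq_top, eq_top_iff, ← hu, Submodule.span_le]
    rintro _ ⟨i, rfl⟩
    refine ⟨Pi.single i (Ideal.Quotient.mk _ 1), ?_⟩
    rw [LinearMap.lsum_piSingle]
    change (Ideal.span {a}).liftQ _ _ (Submodule.Quotient.mk 1) = _
    rw [Submodule.liftQ_apply, LinearMap.toSpanSingleton_apply, one_smul]
  have hbij := hφ.bijective_of_nat_card_le (by
    rw [hcard, Nat.card_pi, Finset.prod_const, Finset.card_univ, Fintype.card_fin])
  exact ⟨(LinearEquiv.ofBijective φ hbij).symm⟩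

end FiniteModules

/-! ### Frobenius-semilinear operators over an algebraically closed field -/

section Lang

variable (k K : Type*) [Field k] [Fintype k] [Field K] [Algebra k K]

/-- The `q`-power Frobenius endomorphism of `K`, where `q` is the number of elements of `k`. -/
abbrev qFrob : K →+* K := (FiniteField.frobeniusAlgHom k K : K →+* K)

variable {k K}

theorem qFrob_apply (x : K) : qFrob k K x = x ^ Fintype.card k := rfl

theorem qFrob_algebraMap (x : k) : qFrob k K (algebraMap k K x) = algebraMap k K x :=
  (FiniteField.frobeniusAlgHom k K).commutes x

theorem mem_range_algebraMap_of_qFrob_eq {x : K} (hx : qFrob k K x = x) :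
    ∃ c : k, algebraMap k K c = x := by
  have hsplit : Splits (X ^ Fintype.card k - X : k[X]) := by
    rw [splits_iff_card_roots, FiniteField.roots_X_pow_card_sub_X, ← Finset.card_def,
      Finset.card_univ, FiniteField.X_pow_card_sub_X_natDegree_eq k Fintype.one_lt_card]
  have hroots := hsplit.roots_map (algebraMap k K)
  have hx' : x ∈ ((X ^ Fintype.card k - X : k[X]).map (algebraMap k K)).roots := by
    rw [mem_roots ((Polynomial.map_ne_zero_iff (algebraMap k K).injective).2
      (FiniteField.X_pow_card_sub_X_ne_zero k Fintype.one_lt_card))]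
    simpa [IsRoot, sub_eq_zero] using hx
  rw [hroots] at hx'
  obtain ⟨c, -, hc⟩ := Multiset.mem_map.1 hx'
  exact ⟨c, hc⟩

variable [IsAlgClosed K]

theorem qFrob_surjective : Function.Surjective (qFrob k K) := fun y =>
  IsAlgClosed.exists_pow_nat_eq y Fintype.card_pos

instance : RingHomSurjective (qFrob k K) := ⟨qFrob_surjective⟩

theorem exists_qFrob_sub_eq (c : K) : ∃ y : K, qFrob k K y - y = c := by
  have hq : 1 < Fintype.card k := Fintype.one_lt_card
  have hd : (X ^ Fintype.card k - X - C c : K[X]).degree = Fintype.card k := by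
    rw [sub_sub, degree_sub_eq_left_of_degree_lt, degree_X_pow]
    rw [degree_X_pow]
    exact (degree_X_add_C c).trans_lt (by exact_mod_cast hq)
  obtain ⟨y, hy⟩ := IsAlgClosed.exists_root (X ^ Fintype.card k - X - C c : K[X]) (by
    rw [hd]; exact_mod_cast Fintype.card_ne_zero)
  refine ⟨y, ?_⟩
  simpa [IsRoot, sub_eq_zero] using hy

/-- The polynomials `P_i(Y)` with `P_0 = c_0 Y ^ q` and `P_{i+1} = P_i ^ q + c_{i+1} Y ^ q`:
the coordinates of a fixed vector of a Frobenius-semilinear operator with companion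
coefficients `c`, as functions of its last coordinate `Y`. -/
def fixedCoord (k : Type*) [Fintype k] (c : ℕ → K) : ℕ → K[X]
  | 0 => C (c 0) * X ^ Fintype.card k
  | i + 1 => fixedCoord k c i ^ Fintype.card k + C (c (i + 1)) * X ^ Fintype.card k

omit [Algebra k K] [IsAlgClosed K] in
theorem natDegree_fixedCoord {c : ℕ → K} (hc : c 0 ≠ 0) (i : ℕ) :
    (fixedCoord k c i).natDegree = Fintype.card k ^ (i + 1) := by
  have hq : 1 < Fintype.card k := Fintype.one_lt_card
  induction i with
  | zero => simpa [fixedCoord] using natDegree_C_mul_X_pow (Fintype.card k) _ hc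
  | succ i ih =>
    rw [fixedCoord, natDegree_add_eq_left_of_natDegree_lt, natDegree_pow, ih, ← pow_succ']
    refine (natDegree_C_mul_X_pow_le _ _).trans_lt ?_
    rw [natDegree_pow, ih, ← pow_succ']
    exact lt_self_pow₀ hq (by omega)

omit [Algebra k K] [IsAlgClosed K] in
theorem X_sq_dvd_fixedCoord (c : ℕ → K) (i : ℕ) : X ^ 2 ∣ fixedCoord k c i := by
  have hq : 2 ≤ Fintype.card k := Fintype.one_lt_card
  induction i with
  | zero => exact (pow_dvd_pow X hq).mul_left _
  | succ i ih =>
    exact dvd_add (ih.trans (dvd_pow_self _ (by omega))) ((pow_dvd_pow X hq).mul_left _)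

omit [Algebra k K] in
theorem exists_eval_fixedCoord_eq {c : ℕ → K} (hc : c 0 ≠ 0) (i : ℕ) :
    ∃ y : K, y ≠ 0 ∧ (fixedCoord k c i).eval y = y := by
  obtain ⟨S, hS⟩ := X_sq_dvd_fixedCoord (k := k) c i
  have hS0 : S ≠ 0 := by
    rintro rfl
    have := natDegree_fixedCoord (k := k) hc i
    rw [hS, mul_zero, natDegree_zero] at this
    exact (pow_pos Fintype.card_pos _).ne this
  have hd : (X * S - C 1 : K[X]).degree ≠ 0 := by
    have h1 : 0 < (X * S).natDegree := by rw [natDegree_X_mul hS0]; omega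
    rw [degree_sub_C (natDegree_pos_iff_degree_pos.1 h1)]
    exact (natDegree_pos_iff_degree_pos.1 h1).ne'
  obtain ⟨y, hy⟩ := IsAlgClosed.exists_root _ hd
  have hy' : y * S.eval y = 1 := by simpa [IsRoot, sub_eq_zero] using hy
  refine ⟨y, left_ne_zero_of_mul_eq_one hy', ?_⟩
  rw [hS, eval_mul, eval_pow, eval_X, pow_two, mul_assoc, hy', mul_one]

variable {W : Type*} [AddCommGroup W] [Module K W]

/-- Take the first `m` for which `τ ^ m v` depends on the lower iterates of some `v ≠ 0`. The fixed
vectors in their span are the solutions of a polynomial equation in the last coordinate, and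
`fixedCoord` provides a nonzero one. -/
theorem exists_ne_zero_fixed [Module.Finite K W] [Nontrivial W] (τ : W →ₛₗ[qFrob k K] W)
    (hτ : Function.Injective τ) : ∃ w : W, w ≠ 0 ∧ τ w = w := by
  classical
  obtain ⟨v, hv⟩ := exists_ne (0 : W)
  let S : ℕ →o Submodule K W :=
    ⟨fun m => Submodule.span K ((fun i => τ^[i] v) '' (Finset.range m : Set ℕ)), fun a b h =>
      Submodule.span_mono (Set.image_mono (by simpa using h))⟩
  have hmem : ∃ m, τ^[m] v ∈ S m := by
    obtain ⟨m, hm⟩ := monotone_stabilizes_iff_noetherian.2 (inferInstance : IsNoetherian K W) S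
    refine ⟨m, ?_⟩
    rw [hm (m + 1) (Nat.le_succ m)]
    exact Submodule.subset_span ⟨m, by simp, rfl⟩
  have hmin := fun {m} => Nat.find_min (m := m) hmem
  have hfind := Nat.find_spec hmem
  set m := Nat.find hmem with hmdef
  obtain ⟨d, hd⟩ : ∃ d, m = d + 1 := by
    refine Nat.exists_eq_succ_of_ne_zero fun h0 => hv ?_
    rw [h0] at hfind
    simpa [S] using hfind
  rw [hd] at hfind hmin
  obtain ⟨c, hc⟩ := (Submodule.mem_span_image_finset_iff_exists_fun' K).1 hfind
  have hlast : τ^[d] v ∉ S d := hmin (Nat.lt_succ_self d)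
  have hS : ∀ (g : ℕ → K), ∑ i ∈ Finset.range d, g i • τ^[i] v ∈ S d := fun g =>
    Submodule.sum_mem _ fun i hi => Submodule.smul_mem _ _
      (Submodule.subset_span ⟨i, by simpa using hi, rfl⟩)
  have hc0 : c 0 ≠ 0 := by
    intro h0
    rw [Finset.sum_range_succ', h0, zero_smul, add_zero] at hc
    choose g hg using fun i => qFrob_surjective (k := k) (c (i + 1))
    refine hlast ?_
    have : τ^[d] v = ∑ i ∈ Finset.range d, g i • τ^[i] v := by
      apply hτ
      rw [map_sum, ← Function.iterate_succ_apply' τ, ← hc]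
      refine Finset.sum_congr rfl fun i _ => ?_
      rw [map_smulₛₗ, hg, Function.iterate_succ_apply']
    rw [this]
    exact hS g
  obtain ⟨y, hy0, hy⟩ := exists_eval_fixedCoord_eq (k := k) hc0 d
  refine ⟨∑ i ∈ Finset.range (d + 1), (fixedCoord k c i).eval y • τ^[i] v, fun h0 => ?_, ?_⟩
  · rw [Finset.sum_range_succ, hy] at h0
    refine hlast ?_
    have h1 : y • τ^[d] v ∈ S d := by
      rw [eq_neg_of_add_eq_zero_right h0]
      exact neg_mem (hS _)
    exact (Submodule.smul_mem_iff _ hy0).1 h1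
  · rw [map_sum, Finset.sum_range_succ]
    simp only [map_smulₛₗ, ← Function.iterate_succ_apply' τ]
    rw [hy, ← hc, Finset.smul_sum, Finset.sum_range_succ', Finset.sum_range_succ',
      ← add_assoc, ← Finset.sum_add_distrib]
    congr 1
    · refine Finset.sum_congr rfl fun i _ => ?_
      rw [smul_smul, ← add_smul, fixedCoord, eval_add, eval_pow, eval_mul, eval_C, eval_pow,
        eval_X, qFrob_apply, qFrob_apply, mul_comm (c (i + 1))]
    · rw [smul_smul, fixedCoord, eval_mul, eval_C, eval_pow, eval_X, qFrob_apply, mul_comm]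

/-- **Lang's theorem** for `GL_d`: an injective Frobenius-semilinear operator on a
finite-dimensional space over an algebraically closed field has a basis of fixed vectors. -/
theorem exists_span_fixed (d : ℕ) : ∀ (W : Type*) [AddCommGroup W] [Module K W]
    [Module.Finite K W] (τ : W →ₛₗ[qFrob k K] W), Function.Injective τ →
    Module.finrank K W = d →
      ∃ v : Fin d → W, Submodule.span K (Set.range v) = ⊤ ∧ ∀ i, τ (v i) = v i := by
  induction d with
  | zero =>
    intro W _ _ _ τ _ hd
    have := Module.finrank_zero_iff.1 hd
    exact ⟨Fin.elim0, Subsingleton.elim _ _, fun i => i.elim0⟩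
  | succ d ih =>
    intro W _ _ _ τ hτ hd
    have : Nontrivial W := Module.nontrivial_of_finrank_pos (R := K) (by omega)
    obtain ⟨w, hw0, hw⟩ := exists_ne_zero_fixed τ hτ
    have hle : Submodule.span K {w} ≤ (Submodule.span K {w}).comap τ := by
      rw [Submodule.span_singleton_le_iff_mem, Submodule.mem_comap, hw]
      exact Submodule.mem_span_singleton_self w
    have hinj : Function.Injective ((Submodule.span K {w}).mapQ (Submodule.span K {w}) τ hle) := by
      rw [injective_iff_map_eq_zero]
      intro x hx
      obtain ⟨x, rfl⟩ := Submodule.Quotient.mk_surjective _ x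
      rw [Submodule.mapQ_apply, Submodule.Quotient.mk_eq_zero] at hx
      obtain ⟨c, hc⟩ := Submodule.mem_span_singleton.1 hx
      obtain ⟨e, rfl⟩ := qFrob_surjective (k := k) c
      rw [Submodule.Quotient.mk_eq_zero]
      refine Submodule.mem_span_singleton.2 ⟨e, hτ ?_⟩
      rw [map_smulₛₗ, hw, hc]
    have hrank : Module.finrank K (W ⧸ Submodule.span K {w}) = d := by
      have h1 := Submodule.finrank_quotient_add_finrank (Submodule.span K {w})
      rw [finrank_span_singleton hw0] at h1
      omega
    obtain ⟨u, hu, hfix⟩ := ih _ _ hinj hrank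
    -- lift each fixed vector, and correct the lift by solving an Artin–Schreier equation
    have hlift : ∀ i, ∃ x : W, (Submodule.span K {w}).mkQ x = u i ∧ τ x = x := by
      intro i
      obtain ⟨x, hx⟩ := Submodule.mkQ_surjective _ (u i)
      have h1 := hfix i
      rw [← hx, Submodule.mkQ_apply, Submodule.mapQ_apply, Submodule.Quotient.eq] at h1
      obtain ⟨c, hc⟩ := Submodule.mem_span_singleton.1 h1
      obtain ⟨y, hy⟩ := exists_qFrob_sub_eq (k := k) (-c)
      refine ⟨x + y • w, ?_, ?_⟩
      · rw [map_add, hx, map_smul, Submodule.mkQ_apply,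
          (Submodule.Quotient.mk_eq_zero _).2 (Submodule.mem_span_singleton_self w), smul_zero,
          add_zero]
      · rw [map_add, map_smulₛₗ, hw, ← sub_eq_zero,
          show τ x + qFrob k K y • w - (x + y • w) = (τ x - x) + (qFrob k K y - y) • w by
            rw [sub_smul]; abel, ← hc, hy, neg_smul, add_neg_cancel]
    choose v hv hvfix using hlift
    refine ⟨Fin.cons w v, ?_, Fin.cases hw hvfix⟩
    rw [Fin.range_cons, Submodule.span_insert, ← Submodule.comap_map_mkQ, Submodule.map_span,
      ← Set.range_comp, show (Submodule.span K {w}).mkQ ∘ v = u from funext hv, hu,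
      Submodule.comap_top]

/-- A finite-dimensional `W` with an injective Frobenius-semilinear `τ` has `q ^ dim W`
linear forms that are compatible with `τ` and the Frobenius of `K`. -/
theorem card_frobenius_equivariant_forms [Module.Finite K W] (τ : W →ₛₗ[qFrob k K] W)
    (hτ : Function.Injective τ) :
    Nat.card {φ : W →ₗ[K] K // ∀ w, φ (τ w) = qFrob k K (φ w)} =
      Fintype.card k ^ Module.finrank K W := by
  obtain ⟨v, hv, hfix⟩ := exists_span_fixed _ W τ hτ rfl
  let b := basisOfTopLeSpanOfCardEqFinrank v hv.ge (Fintype.card_fin _)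
  have hb : ∀ i, τ (b i) = b i := fun i => by
    rw [show b i = v i from congrFun (coe_basisOfTopLeSpanOfCardEqFinrank v hv.ge _) i, hfix]
  let F : (Fin (Module.finrank K W) → k) → {φ : W →ₗ[K] K // ∀ w, φ (τ w) = qFrob k K (φ w)} :=
    fun c => ⟨b.constr K fun i => algebraMap k K (c i), by
      have h : (b.constr K fun i => algebraMap k K (c i)).comp τ =
          (qFrob k K).toSemilinearMap.comp (b.constr K fun i => algebraMap k K (c i)) := by
        refine b.ext fun i => ?_
        rw [LinearMap.comp_apply, LinearMap.comp_apply, hb, Module.Basis.constr_basis]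
        exact (qFrob_algebraMap (c i)).symm
      exact fun w => LinearMap.congr_fun h w⟩
  have hF : Function.Bijective F := by
    constructor
    · intro c c' h
      funext i
      have h1 := LinearMap.congr_fun (congrArg Subtype.val h) (b i)
      simp only [F, Module.Basis.constr_basis] at h1
      exact (algebraMap k K).injective h1
    · rintro ⟨φ, hφ⟩
      choose c hc using fun i => mem_range_algebraMap_of_qFrob_eq (k := k) (x := φ (b i))
        (by rw [← hφ, hb])
      exact ⟨c, Subtype.ext (b.ext fun i => by simp only [F, Module.Basis.constr_basis, hc])⟩
  rw [← Nat.card_congr (Equiv.ofBijective F hF), Nat.card_fun,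
    Nat.card_eq_fintype_card, Nat.card_eq_fintype_card, Fintype.card_fin]

end Lang

/-! ### Twists of polynomials and coprimality -/

section Twist

variable (k K : Type*) [Field k] [Fintype k] [Field K] [Algebra k K]

/-- The twist `∑ c_i X ^ i ↦ ∑ c_i ^ q X ^ i` of polynomials over `K`. -/
abbrev twist : K[X] →+* K[X] := mapRingHom (qFrob k K)

variable {k K}

theorem twist_map_algebraMap (a : k[X]) :
    twist k K (a.map (algebraMap k K)) = a.map (algebraMap k K) := by
  rw [coe_mapRingHom, Polynomial.map_map]
  congr 1
  exact RingHom.ext qFrob_algebraMap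

theorem twist_injective : Function.Injective (twist k K) :=
  Polynomial.map_injective _ (qFrob k K).injective

variable (K) in
/-- The polynomials over `K` that are prime to every `a ∈ k[X]` that is prime to `c`. -/
def coprimeSubmonoid (c : k[X]) : Submonoid K[X] where
  carrier := {g | ∀ a : k[X], IsCoprime a c → IsCoprime (a.map (algebraMap k K)) g}
  one_mem' := fun _ _ => isCoprime_one_right
  mul_mem' := fun hg hh a ha => (hg a ha).mul_right (hh a ha)

theorem twist_mem_coprimeSubmonoid {c : k[X]} {g : K[X]} (hg : g ∈ coprimeSubmonoid K c) :
    twist k K g ∈ coprimeSubmonoid K c := fun a ha => by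
  have := (hg a ha).map (twist k K)
  rwa [twist_map_algebraMap] at this

omit [Fintype k] in
/-- For transcendental roots of `P` there is nothing to do, since no nonzero `a ∈ k[X]` vanishes
there; the minimal polynomials of the algebraic roots are put into `c`. The factor `X` keeps `c`
from being a unit, and so `0` from being prime to `c`. -/
theorem exists_mem_coprimeSubmonoid [IsAlgClosed K] {P : K[X]} (hP : P ≠ 0) :
    ∃ c : k[X], c ≠ 0 ∧ ¬ IsUnit c ∧ P ∈ coprimeSubmonoid K c := by
  classical
  set m : K → k[X] := fun x => if IsIntegral k x then minpoly k x else 1 with hm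
  have hX : ¬ IsUnit (X * ∏ x ∈ P.roots.toFinset, m x : k[X]) := fun h =>
    not_isUnit_X (isUnit_of_mul_isUnit_left h)
  refine ⟨X * ∏ x ∈ P.roots.toFinset, m x,
    mul_ne_zero X_ne_zero (Finset.prod_ne_zero_iff.2 fun x _ => ?_), hX, fun a ha => ?_⟩
  · rw [hm]
    dsimp only
    split_ifs with h
    · exact minpoly.ne_zero h
    · exact one_ne_zero
  · have ha0 : a ≠ 0 := by
      rintro rfl
      exact hX (isCoprime_zero_left.1 ha)
    refine (Polynomial.isCoprime_iff_aeval_ne_zero_of_isAlgClosed K K _ _).2 ?_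
    intro x
    by_contra! h
    obtain ⟨hax, hPx⟩ := h
    rw [aeval_map_algebraMap] at hax
    have hint : IsIntegral k x := IsAlgebraic.isIntegral ⟨a, ha0, hax⟩
    have hxr : x ∈ P.roots.toFinset := by
      rw [Multiset.mem_toFinset, mem_roots hP]
      simpa using hPx
    have hdvd : minpoly k x ∣ X * ∏ x ∈ P.roots.toFinset, m x := by
      refine Dvd.dvd.mul_left ?_ _
      have hmx : m x = minpoly k x := if_pos hint
      exact hmx ▸ Finset.dvd_prod_of_mem m hxr
    rcases aeval_ne_zero_of_isCoprime (ha.of_isCoprime_of_dvd_right hdvd) x with h | h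
    · exact h hax
    · exact h (minpoly.aeval k x)

end Twist

/-! ### Submodules up to torsion by a multiplicative set -/

section Saturation

variable {R M : Type*} [CommRing R] [AddCommGroup M] [Module R M]

/-- The elements of `M` that some element of `Γ` multiplies into `L`. -/
def saturation (Γ : Submonoid R) (L : Submodule R M) : Submodule R M where
  carrier := {m | ∃ g ∈ Γ, g • m ∈ L}
  zero_mem' := ⟨1, one_mem _, by rw [smul_zero]; exact zero_mem _⟩
  add_mem' := by
    rintro x y ⟨g, hg, hx⟩ ⟨h, hh, hy⟩
    refine ⟨g * h, mul_mem hg hh, ?_⟩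
    rw [smul_add]
    refine add_mem ?_ ?_
    · rw [mul_comm, mul_smul]; exact L.smul_mem _ hx
    · rw [mul_smul]; exact L.smul_mem _ hy
  smul_mem' := by
    rintro c x ⟨g, hg, hx⟩
    exact ⟨g, hg, by rw [smul_comm]; exact L.smul_mem _ hx⟩

theorem le_saturation (Γ : Submonoid R) (L : Submodule R M) : L ≤ saturation Γ L := fun m hm =>
  ⟨1, one_mem _, by rwa [one_smul]⟩

theorem mem_saturation_of_smul_mem {Γ : Submonoid R} {L : Submodule R M} {g : R} (hg : g ∈ Γ)
    {m : M} (hm : g • m ∈ saturation Γ L) : m ∈ saturation Γ L := by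
  obtain ⟨h, hh, hm⟩ := hm
  exact ⟨h * g, mul_mem hh hg, by rwa [mul_smul]⟩

theorem saturation_mono (Γ : Submonoid R) {L L' : Submodule R M} (h : L ≤ L') :
    saturation Γ L ≤ saturation Γ L' := fun _ ⟨g, hg, hm⟩ => ⟨g, hg, h hm⟩

/-- A finitely generated submodule that lies in a saturation is carried into `L` by a single
element. -/
theorem exists_forall_smul_mem {Γ : Submonoid R} {L N : Submodule R M} (hN : N.FG)
    (h : N ≤ saturation Γ L) : ∃ g ∈ Γ, ∀ m ∈ N, g • m ∈ L := by
  classical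
  obtain ⟨S, rfl⟩ := hN
  have h' : ∀ m : S, ∃ g ∈ Γ, g • (m : M) ∈ L := fun m => h (Submodule.subset_span m.2)
  choose g hg hgm using h'
  refine ⟨∏ m, g m, prod_mem fun m _ => hg m, fun m hm => ?_⟩
  induction hm using Submodule.span_induction with
  | mem m hm =>
    rw [← Finset.prod_erase_mul _ _ (Finset.mem_univ ⟨m, hm⟩), mul_smul]
    exact L.smul_mem _ (hgm _)
  | zero => rw [smul_zero]; exact zero_mem _
  | add x y _ _ hx hy => rw [smul_add]; exact add_mem hx hy
  | smul c x _ hx => rw [smul_comm]; exact L.smul_mem _ hx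

end Saturation

/-! ### Relations over the twisted polynomial ring -/

section FrobeniusModule

variable {k K : Type*} [Field k] [Fintype k] [Field K] [Algebra k K]
  {M : Type*} [AddCommGroup M] [Module K[X] M] {τ : M →ₛₗ[twist k K] M}

theorem iterate_smul (τ : M →ₛₗ[twist k K] M) (l : ℕ) (g : K[X]) (m : M) :
    τ^[l] (g • m) = (twist k K)^[l] g • τ^[l] m := by
  induction l with
  | zero => rfl
  | succ l ih =>
    rw [Function.iterate_succ_apply', ih, map_smulₛₗ, Function.iterate_succ_apply',
      Function.iterate_succ_apply']

theorem iterate_mem_of_mem_span {S : Set M} {N : Submodule K[X] M} {l : ℕ}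
    (hS : ∀ s ∈ S, τ^[l] s ∈ N) {y : M} (hy : y ∈ Submodule.span K[X] S) : τ^[l] y ∈ N := by
  induction hy using Submodule.span_induction with
  | mem s hs => exact hS s hs
  | zero => rw [iterate_map_zero]; exact zero_mem _
  | add x y _ _ hx hy => rw [iterate_map_add]; exact add_mem hx hy
  | smul c x _ hx => rw [iterate_smul]; exact Submodule.smul_mem _ _ hx

theorem iterate_map_X_smul (τ : M →ₛₗ[twist k K] M) (l : ℕ) (m : M) :
    τ^[l] ((X : K[X]) • m) = (X : K[X]) • τ^[l] m := by
  rw [iterate_smul, Function.iterate_fixed (by rw [coe_mapRingHom, map_X])]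

/-- A nontrivial relation between the `τ ^ b m` expresses a nonzero multiple of the highest iterate
that occurs in it through the lower ones. -/
theorem exists_smul_iterate_mem_span {m : M} (B : ℕ) (p : Fin B → K[X])
    (h : ∑ b, p b • τ^[b] m = 0) (hne : ∃ b, p b ≠ 0) :
    ∃ (d : ℕ) (g : K[X]), g ≠ 0 ∧
      g • τ^[d] m ∈ Submodule.span K[X] (Set.range fun b : Fin d => τ^[b] m) := by
  induction B with
  | zero => exact hne.choose.elim0
  | succ B ih =>
    rw [Fin.sum_univ_castSucc] at h
    by_cases hB : p (Fin.last B) = 0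
    · rw [hB, zero_smul, add_zero] at h
      refine ih _ h ?_
      obtain ⟨b, hb⟩ := hne
      induction b using Fin.lastCases with
      | last => exact (hb hB).elim
      | cast b => exact ⟨b, hb⟩
    · refine ⟨B, _, hB, ?_⟩
      rw [Fin.val_last] at h
      rw [eq_neg_of_add_eq_zero_right h]
      exact neg_mem (Submodule.sum_mem _ fun b _ =>
        Submodule.smul_mem _ _ (Submodule.subset_span ⟨b, rfl⟩))

/-- Applying powers of `τ` to one relation shows that the `τ ^ l m` all lie in the saturation of
the span of the first few of them, for any `Γ` that contains the leading coefficient of the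
relation together with its twists. -/
theorem iterate_mem_saturation {m : M} {d : ℕ} {g : K[X]}
    (h : g • τ^[d] m ∈ Submodule.span K[X] (Set.range fun b : Fin d => τ^[b] m))
    {Γ : Submonoid K[X]} (hΓ : ∀ x ∈ Γ, twist k K x ∈ Γ) (hg : g ∈ Γ) (l : ℕ) :
    τ^[l] m ∈ saturation Γ (Submodule.span K[X] (Set.range fun b : Fin d => τ^[b] m)) := by
  induction l using Nat.strong_induction_on with
  | _ l ih =>
    rcases lt_or_ge l d with hl | hl
    · exact le_saturation _ _ (Submodule.subset_span ⟨⟨l, hl⟩, rfl⟩)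
    · obtain ⟨t, rfl⟩ := Nat.exists_eq_add_of_le' hl
      have hgt : (twist k K)^[t] g ∈ Γ := by
        clear hl ih
        induction t with
        | zero => exact hg
        | succ t iht => rw [Function.iterate_succ_apply']; exact hΓ _ iht
      refine mem_saturation_of_smul_mem hgt ?_
      rw [Function.iterate_add_apply, ← iterate_smul]
      refine iterate_mem_of_mem_span ?_ h
      rintro _ ⟨b, rfl⟩
      dsimp only
      rw [← Function.iterate_add_apply]
      exact ih _ (by omega)

variable [Module K M]

/-- The `K`-span of `τ ^ l (e j)` for `l < i`. -/
def iterSpan (τ : M →ₛₗ[twist k K] M) {n : ℕ} (e : Fin n → M) (i : ℕ) : Submodule K M :=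
  Submodule.span K (Set.range fun x : Fin i × Fin n => τ^[x.1] (e x.2))

variable {n : ℕ} {e : Fin n → M}

theorem iterate_mem_iterSpan {i l : ℕ} (h : l < i) (j : Fin n) : τ^[l] (e j) ∈ iterSpan τ e i :=
  Submodule.subset_span ⟨(⟨l, h⟩, j), rfl⟩

theorem iterSpan_mono : Monotone (iterSpan τ e) := by
  intro i i' h
  refine Submodule.span_le.2 ?_
  rintro _ ⟨x, rfl⟩
  exact iterate_mem_iterSpan (x.1.2.trans_le h) _

theorem finrank_iterSpan_le (i : ℕ) : Module.finrank K (iterSpan τ e i) ≤ i * n := by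
  refine (finrank_range_le_card _).trans ?_
  rw [Fintype.card_prod, Fintype.card_fin, Fintype.card_fin]

instance (i : ℕ) : Module.Finite K (iterSpan τ e i) :=
  Module.Finite.span_of_finite K (Set.finite_range _)

variable [IsScalarTower K K[X] M]

/-- A `twist`-semilinear map of `K[X]`-modules, seen as a Frobenius-semilinear map of
`K`-vector spaces. -/
def restrictFrob (τ : M →ₛₗ[twist k K] M) : M →ₛₗ[qFrob k K] M where
  toFun := τ
  map_add' := map_add τ
  map_smul' c m := by
    rw [← algebraMap_smul K[X] c m, map_smulₛₗ, algebraMap_eq, coe_mapRingHom, map_C,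
      ← algebraMap_eq, algebraMap_smul]

theorem map_mem_iterSpan {i : ℕ} {m : M} (hm : m ∈ iterSpan τ e i) :
    τ m ∈ iterSpan τ e (i + 1) := by
  change restrictFrob τ m ∈ _
  induction hm using Submodule.span_induction with
  | mem m hm =>
    obtain ⟨x, rfl⟩ := hm
    change τ _ ∈ _
    dsimp only
    rw [← Function.iterate_succ_apply' τ]
    exact iterate_mem_iterSpan (by omega) _
  | zero => rw [map_zero]; exact zero_mem _
  | add x y _ _ hx hy => rw [map_add]; exact add_mem hx hy
  | smul c x _ hx => rw [map_smulₛₗ]; exact Submodule.smul_mem _ _ hx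

theorem iterate_map_mem_iterSpan {i : ℕ} {m : M} (hm : m ∈ iterSpan τ e i) (l : ℕ) :
    τ^[l] m ∈ iterSpan τ e (i + l) := by
  induction l with
  | zero => exact hm
  | succ l ih => rw [Function.iterate_succ_apply']; exact map_mem_iterSpan ih

theorem X_pow_smul_mem_iterSpan {s : ℕ} (hs : ∀ j, (X : K[X]) • e j ∈ iterSpan τ e s) (a : ℕ)
    {i : ℕ} {m : M} (hm : m ∈ iterSpan τ e i) :
    (X ^ a : K[X]) • m ∈ iterSpan τ e (i + s * a) := by
  induction a with
  | zero => simpa using hm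
  | succ a ih =>
    rw [pow_succ', mul_smul, Nat.mul_succ, ← add_assoc]
    generalize (X ^ a : K[X]) • m = m' at ih
    induction ih using Submodule.span_induction with
    | mem m hm =>
      obtain ⟨x, rfl⟩ := hm
      dsimp only
      rw [← iterate_map_X_smul]
      exact iterSpan_mono (by omega) (iterate_map_mem_iterSpan (hs x.2) x.1)
    | zero => rw [smul_zero]; exact zero_mem _
    | add x y _ _ hx hy => rw [smul_add]; exact add_mem hx hy
    | smul c x _ hx => rw [smul_comm]; exact Submodule.smul_mem _ _ hx

/-- If `M` is finitely generated over `K{τ}`, then each `m` satisfies a nontrivial relation over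
`K[X]{τ}`: the `K`-span of `X ^ a τ ^ b m` with `a ≤ n` and `b < B` lies in an `iterSpan` of
dimension `n B + O(1)`, too small for `(n + 1) B` independent elements. -/
theorem exists_relation (hgen : ∀ m : M, ∃ i, m ∈ iterSpan τ e i) (m : M) :
    ∃ (B : ℕ) (p : Fin B → K[X]), ∑ b, p b • τ^[b] m = 0 ∧ ∃ b, p b ≠ 0 := by
  classical
  obtain ⟨s, hs⟩ : ∃ s, ∀ j, (X : K[X]) • e j ∈ iterSpan τ e s := by
    choose s hs using fun j => hgen ((X : K[X]) • e j)
    exact ⟨Finset.univ.sup s, fun j => iterSpan_mono (Finset.le_sup (Finset.mem_univ j)) (hs j)⟩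
  obtain ⟨t, ht⟩ := hgen m
  set B := (t + s * (n + 1)) * n + 1 with hB
  let v : Fin (n + 1) × Fin B → M := fun x => (X ^ (x.1 : ℕ) : K[X]) • τ^[x.2] m
  have hv : ∀ x, v x ∈ iterSpan τ e (t + B + s * (n + 1)) := fun x =>
    iterSpan_mono (by
      have h1 : s * (x.1 : ℕ) ≤ s * (n + 1) := Nat.mul_le_mul_left s x.1.2.le
      have h2 := x.2.2
      omega) (X_pow_smul_mem_iterSpan hs x.1 (iterate_map_mem_iterSpan ht x.2))
  have hdep : ¬ LinearIndependent K v := by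
    intro hli
    have hli' : LinearIndependent K
        fun x => (⟨v x, hv x⟩ : iterSpan τ e (t + B + s * (n + 1))) :=
      LinearIndependent.of_comp (Submodule.subtype _) hli
    have h1 := hli'.fintype_card_le_finrank.trans (finrank_iterSpan_le _)
    rw [Fintype.card_prod, Fintype.card_fin, Fintype.card_fin] at h1
    have h2 : (t + B + s * (n + 1)) * n = (t + s * (n + 1)) * n + n * B := by ring
    have h3 : (n + 1) * B = n * B + B := by ring
    omega
  obtain ⟨g, hg, ⟨a₀, b₀⟩, hne⟩ := Fintype.not_linearIndependent_iff.1 hdep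
  refine ⟨B, fun b => ∑ a : Fin (n + 1), monomial a (g (a, b)), ?_, b₀, fun h0 => hne ?_⟩
  · rw [← hg, Fintype.sum_prod_type_right]
    refine Finset.sum_congr rfl fun b _ => ?_
    rw [Finset.sum_smul]
    refine Finset.sum_congr rfl fun a _ => ?_
    rw [← C_mul_X_pow_eq_monomial, mul_smul, ← algebraMap_eq, algebraMap_smul]
  · have := congrArg (fun p => coeff p (a₀ : ℕ)) h0
    simpa [finsetSum_coeff, coeff_monomial, Fin.val_inj] using this

end FrobeniusModule

/-! ### Finite rank and bases up to torsion -/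

section Rank

variable {R : Type*} (S : Type*) {M : Type*} [CommRing R] [IsDomain R] [Field S] [Algebra R S]
  [IsFractionRing R S] [AddCommGroup M] [Module R M]

theorem finite_tensorProduct_of_saturation_eq_top {L : Submodule R M} (hL : L.FG)
    (h : saturation (nonZeroDivisors R) L = ⊤) : Module.Finite S (S ⊗[R] M) := by
  have : Module.Finite R L := Module.Finite.iff_fg.2 hL
  refine Module.Finite.of_surjective (L.subtype.baseChange S) fun x => ?_
  induction x with
  | zero => exact ⟨0, map_zero _⟩
  | add x y hx hy =>
    obtain ⟨x', rfl⟩ := hx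
    obtain ⟨y', rfl⟩ := hy
    exact ⟨x' + y', map_add _ _ _⟩
  | tmul s m =>
    obtain ⟨g, hg, hm⟩ : m ∈ saturation (nonZeroDivisors R) L := h ▸ Submodule.mem_top
    have hg0 : algebraMap R S g ≠ 0 :=
      IsFractionRing.to_map_ne_zero_of_mem_nonZeroDivisors hg
    refine ⟨(s / algebraMap R S g) ⊗ₜ ⟨g • m, hm⟩, ?_⟩
    rw [LinearMap.baseChange_tmul, Submodule.subtype_apply, ← TensorProduct.smul_tmul,
      Algebra.smul_def, mul_div_cancel₀ _ hg0]

/-- A maximal linearly independent family generates `M` up to torsion. -/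
theorem exists_linearIndependent_saturation_eq_top [Module.Finite S (S ⊗[R] M)] :
    ∃ b : Fin (Module.finrank S (S ⊗[R] M)) → M, LinearIndependent R b ∧
      saturation (nonZeroDivisors R) (Submodule.span R (Set.range b)) = ⊤ := by
  have : FaithfulSMul R S := (faithfulSMul_iff_algebraMap_injective R S).2
    (IsFractionRing.injective R S)
  have hbc := TensorProduct.isBaseChange R M S
  rw [hbc.finrank_eq]
  obtain ⟨b, hb⟩ := exists_linearIndependent_of_le_finrank (R := R) (M := M) le_rfl
  refine ⟨b, hb, eq_top_iff.2 fun m _ => ?_⟩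
  have hfin : Module.rank R M < Cardinal.aleph0 := by
    have h1 := hbc.lift_rank_eq
    have h2 : Module.rank S (S ⊗[R] M) < Cardinal.aleph0 := Module.rank_lt_aleph0 _ _
    rw [← Cardinal.lift_lt_aleph0, ← h1, Cardinal.lift_lt_aleph0]
    exact h2
  have hdep : ¬ LinearIndependent R (Fin.cons m b : Fin (Module.finrank R M + 1) → M) := by
    intro hli
    have h1 := hli.cardinal_lift_le_rank
    rw [Cardinal.mk_fin, Cardinal.lift_natCast, ← Cardinal.cast_toNat_of_lt_aleph0 hfin,
      Cardinal.lift_natCast, Nat.cast_le] at h1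
    exact absurd h1 (by rw [Module.finrank]; omega)
  obtain ⟨g, hg, hne⟩ := Fintype.not_linearIndependent_iff.1 hdep
  rw [Fin.sum_univ_succ] at hg
  simp only [Fin.cons_zero, Fin.cons_succ] at hg
  have hg0 : g 0 ≠ 0 := by
    intro h0
    rw [h0, zero_smul, zero_add] at hg
    have := Fintype.linearIndependent_iff.1 hb _ hg
    obtain ⟨i, hi⟩ := hne
    exact hi (Fin.cases h0 this i)
  refine ⟨g 0, mem_nonZeroDivisors_of_ne_zero hg0, ?_⟩
  rw [eq_neg_of_add_eq_zero_left hg]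
  exact neg_mem (Submodule.sum_mem _ fun i _ =>
    Submodule.smul_mem _ _ (Submodule.subset_span ⟨i, rfl⟩))

end Rank

/-! ### Reduction modulo a scalar prime to the torsion -/

section Quotient

variable {R : Type*} {M : Type*} [CommRing R] [AddCommGroup M] [Module R M]

/-- If `M` is, up to torsion prime to `a`, free on `b`, then `M / aM` is free over `R / a` on the
image of `b`. -/
theorem nonempty_quotient_range_lsmul_equiv {r : ℕ} {b : Fin r → M} (hb : LinearIndependent R b)
    {Γ : Submonoid R} (hΓ : saturation Γ (Submodule.span R (Set.range b)) = ⊤) {a : R}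
    (ha : ∀ g ∈ Γ, IsCoprime a g) :
    Nonempty ((Fin r → R ⧸ Ideal.span {a}) ≃ₗ[R] M ⧸ LinearMap.range (LinearMap.lsmul R M a)) := by
  set L := Submodule.span R (Set.range b) with hL
  set N := LinearMap.range (LinearMap.lsmul R M a) with hN
  have hsat : ∀ m : M, ∃ u v : R, u • m ∈ L ∧ m = u • m + a • v • m := by
    intro m
    obtain ⟨g, hg, hm⟩ : m ∈ saturation Γ L := hΓ ▸ Submodule.mem_top
    obtain ⟨v, u, huv⟩ := ha g hg
    refine ⟨u * g, v, by rw [mul_smul]; exact L.smul_mem _ hm, ?_⟩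
    rw [smul_smul, ← add_smul, mul_comm a, add_comm, huv, one_smul]
  let ψ : (Fin r → R) →ₗ[R] M ⧸ N := N.mkQ.comp (Fintype.linearCombination R b)
  have hψ : Function.Surjective ψ := by
    intro y
    obtain ⟨m, rfl⟩ := N.mkQ_surjective y
    obtain ⟨u, v, hu, hm⟩ := hsat m
    obtain ⟨c, hc⟩ := (Submodule.mem_span_range_iff_exists_fun R).1 hu
    refine ⟨c, ?_⟩
    rw [LinearMap.comp_apply, Fintype.linearCombination_apply, hc, Submodule.mkQ_apply,
      Submodule.mkQ_apply, Submodule.Quotient.eq, hN]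
    exact ⟨-(v • m), by
      rw [LinearMap.lsmul_apply, smul_neg, neg_eq_iff_add_eq_zero]
      nth_rewrite 3 [hm]
      abel⟩
  have hker : LinearMap.ker ψ = Submodule.pi Set.univ fun _ => Ideal.span {a} := by
    ext c
    rw [LinearMap.mem_ker, LinearMap.comp_apply, Submodule.mkQ_apply,
      Submodule.Quotient.mk_eq_zero, Fintype.linearCombination_apply, Submodule.mem_pi]
    simp only [Set.mem_univ, true_implies, Ideal.mem_span_singleton]
    constructor
    · rintro ⟨m, hm⟩
      rw [LinearMap.lsmul_apply] at hm
      -- since `a • m` and a multiple of `m` prime to `a` lie in `L`, so does `m`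
      have hmL : m ∈ L := by
        obtain ⟨u, v, hu, hm'⟩ := hsat m
        rw [hm']
        refine add_mem hu ?_
        rw [smul_comm, hm]
        exact L.smul_mem _ (Submodule.sum_mem _ fun i _ =>
          Submodule.smul_mem _ _ (Submodule.subset_span ⟨i, rfl⟩))
      obtain ⟨d, hd⟩ := (Submodule.mem_span_range_iff_exists_fun R).1 hmL
      have h0 : ∑ i, (c i - a * d i) • b i = 0 := by
        simp only [sub_smul, mul_smul]
        rw [Finset.sum_sub_distrib, ← Finset.smul_sum, hd, hm, sub_self]
      intro i
      exact ⟨d i, sub_eq_zero.1 (Fintype.linearIndependent_iff.1 hb _ h0 i)⟩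
    · intro h
      choose d hd using h
      refine ⟨∑ i, d i • b i, ?_⟩
      rw [LinearMap.lsmul_apply, Finset.smul_sum]
      exact Finset.sum_congr rfl fun i _ => by rw [hd, mul_smul]
  exact ⟨(Submodule.quotientPi fun _ => Ideal.span {a}).symm ≪≫ₗ
    Submodule.quotEquivOfEq _ _ hker.symm ≪≫ₗ LinearMap.quotKerEquivOfSurjective ψ hψ⟩

end Quotient

/-! ### Finiteness and the count of equivariant forms -/

section FrobeniusModule

variable {k K : Type*} [Field k] [Fintype k] [Field K] [Algebra k K]
  {M : Type*} [AddCommGroup M] [Module K[X] M] {τ : M →ₛₗ[twist k K] M}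

instance [IsAlgClosed K] : RingHomSurjective (twist k K) :=
  ⟨Polynomial.map_surjective _ qFrob_surjective⟩

/-- If `τ` is injective and `X - θ` maps `M` into `τ M`, then `τ` stays injective on `M / aM` as
soon as `a(θ) ≠ 0`. -/
theorem mem_range_lsmul_of_map_mem [IsAlgClosed K] (hτ : Function.Injective τ) {θ : K}
    (hθ : ∀ m : M, (X - C θ : K[X]) • m ∈ LinearMap.range τ) {a : k[X]} (ha : aeval θ a ≠ 0)
    {m : M} (hm : τ m ∈ LinearMap.range (LinearMap.lsmul K[X] M (a.map (algebraMap k K)))) :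
    m ∈ LinearMap.range (LinearMap.lsmul K[X] M (a.map (algebraMap k K))) := by
  obtain ⟨g, hg⟩ := hm
  rw [LinearMap.lsmul_apply] at hg
  set a' := a.map (algebraMap k K) with ha'
  obtain ⟨s, hs⟩ := X_sub_C_dvd_sub_C_eval (a := θ) (p := a')
  have hev : a'.eval θ = aeval θ a := by rw [ha', eval_map_algebraMap]
  have h1 : C (a'.eval θ) • g ∈ LinearMap.range τ := by
    have h2 : C (a'.eval θ) • g = τ m - (X - C θ : K[X]) • s • g := by
      rw [smul_smul, ← hs, sub_smul, hg, sub_sub_cancel]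
    rw [h2]
    exact sub_mem ⟨m, rfl⟩ (hθ _)
  have h3 : g ∈ LinearMap.range τ := by
    have h4 := Submodule.smul_mem _ (C (a'.eval θ)⁻¹) h1
    rwa [smul_smul, ← C_mul, inv_mul_cancel₀ (hev ▸ ha), C_1, one_smul] at h4
  obtain ⟨h, rfl⟩ := h3
  refine ⟨h, hτ ?_⟩
  rw [LinearMap.lsmul_apply, map_smulₛₗ, ha', twist_map_algebraMap, ← ha', hg]

variable [Module K M] [IsScalarTower K K[X] M] {n : ℕ} {e : Fin n → M}

/-- If `M` is finitely generated over `K{τ}`, then it is finitely generated over `K[X]` up to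
torsion by products of twists of finitely many nonzero polynomials. -/
theorem exists_fg_saturation_eq_top (hgen : ∀ m : M, ∃ i, m ∈ iterSpan τ e i) :
    ∃ (L : Submodule K[X] M) (p : Fin n → K[X]), L.FG ∧ (∀ j, p j ≠ 0) ∧
      ∀ Γ : Submonoid K[X], (∀ x ∈ Γ, twist k K x ∈ Γ) → (∀ j, p j ∈ Γ) →
        saturation Γ L = ⊤ := by
  have h : ∀ j, ∃ (d : ℕ) (g : K[X]), g ≠ 0 ∧
      g • τ^[d] (e j) ∈ Submodule.span K[X] (Set.range fun b : Fin d => τ^[b] (e j)) := by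
    intro j
    obtain ⟨B, p, hp, hne⟩ := exists_relation hgen (e j)
    exact exists_smul_iterate_mem_span B p hp hne
  choose d p hp0 hp using h
  refine ⟨⨆ j, Submodule.span K[X] (Set.range fun b : Fin (d j) => τ^[b] (e j)), p,
    Submodule.fg_iSup _ fun j => Submodule.fg_span (Set.finite_range _), hp0,
    fun Γ hΓ hpΓ => eq_top_iff.2 fun m _ => ?_⟩
  obtain ⟨i, hi⟩ := hgen m
  induction hi using Submodule.span_induction with
  | mem m hm =>
    obtain ⟨x, rfl⟩ := hm
    exact saturation_mono Γ (le_iSup (fun j => Submodule.span K[X]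
      (Set.range fun b : Fin (d j) => τ^[b] (e j))) x.2)
      (iterate_mem_saturation (hp x.2) hΓ (hpΓ x.2) x.1)
  | zero => exact zero_mem _
  | add x y _ _ hx hy => exact add_mem (hx trivial) (hy trivial)
  | smul c x _ hx =>
    rw [← algebraMap_smul K[X] c x]
    exact Submodule.smul_mem _ _ (hx trivial)

variable [IsAlgClosed K]

/-- The `τ`-equivariant linear forms on `M` that vanish on `aM` are those on `M / aM`, which has
dimension `r deg a` and on which `τ` is injective. -/
theorem card_forms_quotient (hτ : Function.Injective τ) {θ : K}
    (hθ : ∀ m : M, (X - C θ : K[X]) • m ∈ LinearMap.range τ) {a : k[X]} (ha : aeval θ a ≠ 0)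
    {r : ℕ} (e : (Fin r → K[X] ⧸ Ideal.span {a.map (algebraMap k K)}) ≃ₗ[K[X]]
      M ⧸ LinearMap.range (LinearMap.lsmul K[X] M (a.map (algebraMap k K)))) :
    Nat.card {φ : M →ₗ[K] K // (∀ m, φ (τ m) = qFrob k K (φ m)) ∧
      ∀ m, φ (a.map (algebraMap k K) • m) = 0} = (Fintype.card k ^ a.natDegree) ^ r := by
  set a' := a.map (algebraMap k K) with ha'
  have ha0 : a' ≠ 0 := by
    rw [ha', Polynomial.map_ne_zero_iff (algebraMap k K).injective]
    rintro rfl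
    exact ha (map_zero _)
  set N := LinearMap.range (LinearMap.lsmul K[X] M a') with hN
  let N' : Submodule K M := N.restrictScalars K
  have : Module.Finite K (K[X] ⧸ Ideal.span {a'}) :=
    (AdjoinRoot.powerBasis ha0).finite
  let e' : (Fin r → K[X] ⧸ Ideal.span {a'}) ≃ₗ[K] M ⧸ N' :=
    e.restrictScalars K ≪≫ₗ (Submodule.Quotient.restrictScalarsEquiv K N).symm
  have : Module.Finite K (M ⧸ N') := Module.Finite.equiv e'
  have hrank : Module.finrank K (M ⧸ N') = a.natDegree * r := by
    rw [← e'.finrank_eq, Module.finrank_pi_fintype, finrank_quotient_span_eq_natDegree, ha',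
      natDegree_map, Finset.sum_const, Finset.card_univ, Fintype.card_fin, smul_eq_mul, mul_comm]
  have hle : N' ≤ N'.comap (restrictFrob τ) := by
    rintro _ ⟨m, rfl⟩
    refine ⟨τ m, ?_⟩
    change a' • τ m = τ (a' • m)
    rw [map_smulₛₗ, ha', twist_map_algebraMap]
  have hinj : Function.Injective (N'.mapQ N' (restrictFrob τ) hle) := by
    rw [injective_iff_map_eq_zero]
    intro x hx
    obtain ⟨m, rfl⟩ := Submodule.Quotient.mk_surjective _ x
    rw [Submodule.mapQ_apply, Submodule.Quotient.mk_eq_zero] at hx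
    exact (Submodule.Quotient.mk_eq_zero _).2 (mem_range_lsmul_of_map_mem hτ hθ ha hx)
  rw [← pow_mul, ← hrank, ← card_frobenius_equivariant_forms _ hinj]
  refine Nat.card_congr
    { toFun := fun φ => ⟨N'.liftQ φ.1 ?_, fun w => ?_⟩
      invFun := fun φ => ⟨φ.1.comp N'.mkQ, fun m => ?_, fun m => ?_⟩
      left_inv := fun φ => Subtype.ext (LinearMap.ext fun m => rfl)
      right_inv := fun φ => Subtype.ext (LinearMap.ext fun w => ?_) }
  · rintro _ ⟨m, rfl⟩
    exact φ.2.2 m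
  · obtain ⟨m, rfl⟩ := Submodule.Quotient.mk_surjective _ w
    exact φ.2.1 m
  · exact φ.2 (Submodule.Quotient.mk m)
  · rw [LinearMap.comp_apply, Submodule.mkQ_apply, (Submodule.Quotient.mk_eq_zero _).2, map_zero]
    exact ⟨m, rfl⟩
  · obtain ⟨m, rfl⟩ := Submodule.Quotient.mk_surjective _ w
    rfl

theorem finite_and_exists_card_forms (hτ : Function.Injective τ)
    (hgen : ∀ m : M, ∃ i, m ∈ iterSpan τ e i) {θ : K}
    (hθ : ∀ m : M, (X - C θ : K[X]) • m ∈ LinearMap.range τ) :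
    Module.Finite (RatFunc K) (RatFunc K ⊗[K[X]] M) ∧
      ∃ c : k[X], c ≠ 0 ∧ ¬ IsUnit c ∧ ∀ a : k[X], IsCoprime a c →
        Nat.card {φ : M →ₗ[K] K // (∀ m, φ (τ m) = qFrob k K (φ m)) ∧
          ∀ m, φ (a.map (algebraMap k K) • m) = 0} =
            (Fintype.card k ^ a.natDegree) ^
              Module.finrank (RatFunc K) (RatFunc K ⊗[K[X]] M) := by
  obtain ⟨L, p, hL, hp0, hsat⟩ := exists_fg_saturation_eq_top hgen
  have hfin : Module.Finite (RatFunc K) (RatFunc K ⊗[K[X]] M) :=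
    finite_tensorProduct_of_saturation_eq_top _ hL (hsat _
      (fun x hx => mem_nonZeroDivisors_of_ne_zero ((map_ne_zero_iff _ twist_injective).2
        (nonZeroDivisors.ne_zero hx))) fun j => mem_nonZeroDivisors_of_ne_zero (hp0 j))
  refine ⟨hfin, ?_⟩
  obtain ⟨b, hb, hbsat⟩ := exists_linearIndependent_saturation_eq_top (R := K[X]) (M := M)
    (RatFunc K)
  obtain ⟨g, hg, hgL⟩ := exists_forall_smul_mem hL (hbsat ▸ le_top)
  obtain ⟨c, hc0, hc1, hc⟩ := exists_mem_coprimeSubmonoid (k := k)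
    (P := (X - C θ) * g * ∏ j, p j) (mul_ne_zero (mul_ne_zero (X_sub_C_ne_zero θ)
      (nonZeroDivisors.ne_zero hg)) (Finset.prod_ne_zero_iff.2 fun j _ => hp0 j))
  have hdvd : ∀ f : K[X], f ∣ (X - C θ) * g * ∏ j, p j → f ∈ coprimeSubmonoid K c :=
    fun f hf a ha => (hc a ha).of_isCoprime_of_dvd_right hf
  have hsat' := hsat (coprimeSubmonoid K c) (fun x => twist_mem_coprimeSubmonoid)
    fun j => hdvd _ ((Finset.dvd_prod_of_mem p (Finset.mem_univ j)).mul_left _)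
  have hbsat' : saturation (coprimeSubmonoid K c) (Submodule.span K[X] (Set.range b)) = ⊤ := by
    refine eq_top_iff.2 fun m _ => ?_
    obtain ⟨h, hh, hm⟩ : m ∈ saturation (coprimeSubmonoid K c) L := hsat' ▸ Submodule.mem_top
    exact ⟨g * h, mul_mem (hdvd _ ((dvd_mul_left _ _).mul_right _)) hh, by
      rw [mul_smul]; exact hgL _ hm⟩
  refine ⟨c, hc0, hc1, fun a ha => ?_⟩
  obtain ⟨e⟩ := nonempty_quotient_range_lsmul_equiv hb hbsat' fun g hg => hg a ha
  refine card_forms_quotient hτ hθ ?_ e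
  have h1 := hdvd (X - C θ) ((dvd_mul_right _ _).mul_right _) a ha
  rcases aeval_ne_zero_of_isCoprime h1 θ with h | h
  · rwa [aeval_map_algebraMap] at h
  · simp at h

end FrobeniusModule

/-! ### Semilinear operators on modules over a polynomial ring -/

section AEval

variable {k K : Type*} [Field k] [Fintype k] [Field K] [Algebra k K]
  {V : Type*} [AddCommGroup V] [Module K V]

/-- A Frobenius-semilinear operator that commutes with `φ`, as a `twist`-semilinear operator on
the `K[X]`-module on which `X` acts as `φ`. -/
def aevalFrob {φ : Module.End K V} {σ : V →ₛₗ[qFrob k K] V} (h : ∀ v, σ (φ v) = φ (σ v)) :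
    Module.AEval' φ →ₛₗ[twist k K] Module.AEval' φ where
  toFun m := Module.AEval'.of φ (σ ((Module.AEval'.of φ).symm m))
  map_add' x y := by rw [map_add, map_add, map_add]
  map_smul' p m := by
    obtain ⟨g, rfl⟩ := (Module.AEval'.of φ).surjective m
    induction p using Polynomial.induction_on' with
    | add p p' hp hp' => rw [add_smul, map_add, map_add, map_add, hp, hp', map_add, add_smul]
    | monomial i c =>
      have hi : σ ((φ ^ i) g) = (φ ^ i) (σ g) := by
        induction i with
        | zero => rfl
        | succ i ih => rw [pow_succ', Module.End.mul_apply, Module.End.mul_apply, h, ih]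
      rw [coe_mapRingHom, Polynomial.map_monomial, ← C_mul_X_pow_eq_monomial,
        ← C_mul_X_pow_eq_monomial, mul_smul, mul_smul, LinearEquiv.symm_apply_apply,
        Module.AEval'.X_pow_smul_of, Module.AEval'.X_pow_smul_of, Module.AEval.C_smul,
        Module.AEval.C_smul, map_smul, map_smulₛₗ, map_smul, LinearEquiv.symm_apply_apply,
        Module.End.smul_def, Module.End.smul_def, hi]

end AEval

namespace QVar

/-! ### Linear parts of additive polynomials -/

section LinearPart

variable {k K : Type*} [Field k] [Fintype k] [Field K] [Algebra k K] {n : ℕ}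

theorem Lam.frob_mem {f : MvPolynomial (Fin n) K} (hf : f ∈ Lam k K n) :
    f ^ Fintype.card k ∈ Lam k K n := by
  simpa using Lam.pow_mem hf 1

omit [Field k] [Algebra k K] in
theorem Lam.linearMap_ext {V : Type*} [AddCommGroup V] [Module K V] {φ ψ : Lam k K n →ₗ[K] V}
    (h : ∀ (j : Fin n) (l : ℕ),
      φ ⟨MvPolynomial.X j ^ (Fintype.card k ^ l), Submodule.subset_span ⟨j, l, rfl⟩⟩ =
        ψ ⟨MvPolynomial.X j ^ (Fintype.card k ^ l), Submodule.subset_span ⟨j, l, rfl⟩⟩) :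
    φ = ψ := by
  refine LinearMap.ext fun f => ?_
  obtain ⟨f, hf⟩ := f
  induction hf using Submodule.span_induction with
  | mem f hf => obtain ⟨j, l, rfl⟩ := hf; exact h j l
  | zero => exact (map_zero φ).trans (map_zero ψ).symm
  | add f g hf hg ihf ihg =>
    exact (map_add φ ⟨f, hf⟩ ⟨g, hg⟩).trans
      ((congrArg₂ (· + ·) ihf ihg).trans (map_add ψ ⟨f, hf⟩ ⟨g, hg⟩).symm)
  | smul c f hf ih =>
    exact (map_smul φ c ⟨f, hf⟩).trans
      ((congrArg (c • ·) ih).trans (map_smul ψ c ⟨f, hf⟩).symm)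

theorem linPart_frob {f : MvPolynomial (Fin n) K} (hf : f ∈ Lam k K n) :
    linPart (f ^ Fintype.card k) = 0 := by
  simpa using linPart_pow hf 1 one_ne_zero

variable [IsAlgClosed K]

/-- Coefficients have `q`-th roots, so the terms `X_i ^ (q ^ j)` with `j > 0` of an additive
polynomial form a `q`-th power. -/
theorem Lam.exists_eq_linear_add_frob {f : MvPolynomial (Fin n) K} (hf : f ∈ Lam k K n) :
    ∃ (c : Fin n → K), ∃ v ∈ Lam k K n,
      f = ∑ i, c i • MvPolynomial.X i + v ^ Fintype.card k := by
  classical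
  induction hf using Submodule.span_induction with
  | mem f h =>
    obtain ⟨i, j, rfl⟩ := h
    rcases j with _ | j
    · refine ⟨Pi.single i 1, 0, zero_mem _, ?_⟩
      rw [zero_pow Fintype.card_ne_zero, add_zero, pow_zero, pow_one,
        Finset.sum_eq_single i (fun l _ hl => by rw [Pi.single_eq_of_ne hl, zero_smul])
          (fun h => (h (Finset.mem_univ i)).elim), Pi.single_eq_same, one_smul]
    · refine ⟨0, _, Submodule.subset_span ⟨i, j, rfl⟩, ?_⟩
      simp [← pow_mul, pow_succ]
  | zero => exact ⟨0, 0, zero_mem _, by simp [zero_pow Fintype.card_ne_zero]⟩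
  | add f g _ _ hf hg =>
    obtain ⟨c, v, hv, rfl⟩ := hf
    obtain ⟨d, w, hw, rfl⟩ := hg
    refine ⟨c + d, v + w, add_mem hv hw, ?_⟩
    have hadd := map_add (FiniteField.frobeniusAlgHom k (MvPolynomial (Fin n) K)) v w
    simp only [FiniteField.coe_frobeniusAlgHom] at hadd
    rw [hadd]
    simp only [Pi.add_apply, add_smul, Finset.sum_add_distrib]
    ring
  | smul a f _ hf =>
    obtain ⟨c, v, hv, rfl⟩ := hf
    obtain ⟨b, rfl⟩ := qFrob_surjective (k := k) a
    refine ⟨qFrob k K b • c, b • v, Submodule.smul_mem _ _ hv, ?_⟩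
    rw [smul_add, Finset.smul_sum, _root_.smul_pow]
    simp only [Pi.smul_apply, smul_smul, smul_eq_mul, qFrob_apply]

theorem Lam.exists_frob_eq_of_linPart_eq_zero {f : MvPolynomial (Fin n) K} (hf : f ∈ Lam k K n)
    (h0 : linPart f = 0) : ∃ v ∈ Lam k K n, f = v ^ Fintype.card k := by
  classical
  obtain ⟨c, v, hv, rfl⟩ := Lam.exists_eq_linear_add_frob hf
  rw [map_add, linPart_frob hv, add_zero] at h0
  refine ⟨v, hv, ?_⟩
  rw [Finset.sum_eq_zero, zero_add]
  intro j _
  have h1 := LinearMap.congr_fun h0 (Pi.single j 1)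
  simp only [map_sum, map_smul, LinearMap.sum_apply, LinearMap.smul_apply, linPart_X,
    LinearMap.zero_apply] at h1
  rw [Finset.sum_eq_single j (fun l _ hl => by rw [Pi.single_eq_of_ne hl, smul_zero])
    (fun h => (h (Finset.mem_univ j)).elim), Pi.single_eq_same, smul_eq_mul, mul_one] at h1
  rw [h1, zero_smul]

end LinearPart

/-! ### Functions on a variety and their cotangent space -/

section Functions

variable {k K : Type*} [Field k] [Fintype k] [Field K] [Algebra k K] {n : ℕ}

/-- Restriction of `𝔽_q`-linear polynomials to functions on `F`. -/
def restrict (F : QVariety k K n) : Lam k K n →ₗ[K] Fun F where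
  toFun f := ⟨{ toFun x := MvPolynomial.eval (x : Fin n → K) f.1
                map_add' _ _ := Lam.eval_add f.2 _ _
                map_smul' c _ := Lam.eval_smul f.2 c _ }, f.1, f.2, fun _ => rfl⟩
  map_add' f g := Subtype.ext (LinearMap.ext fun _ => map_add (MvPolynomial.eval _) f.1 g.1)
  map_smul' c f := Subtype.ext (LinearMap.ext fun _ => MvPolynomial.smul_eval _ f.1 c)

variable {F : QVariety k K n}

instance : AddCommGroup (Fun F) := Submodule.addCommGroup (Fun F)

theorem restrict_apply (f : Lam k K n) (x : F.carrier) :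
    (restrict F f).1 x = MvPolynomial.eval (x : Fin n → K) f.1 := rfl

theorem restrict_surjective : Function.Surjective (restrict F) := by
  rintro ⟨g, f, hf, hg⟩
  exact ⟨⟨f, hf⟩, Subtype.ext (LinearMap.ext fun x => (hg x).symm)⟩

variable (F) in
/-- The operator `g ↦ g ^ q` on `K{F}`. -/
def frobFun : Fun F →ₛₗ[qFrob k K] Fun F where
  toFun g := ⟨(FiniteField.frobeniusAlgHom k K).toLinearMap ∘ₗ g.1, by
    obtain ⟨f, hf, hg⟩ := g.2
    exact ⟨_, Lam.frob_mem hf, fun x => by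
      rw [map_pow, ← hg, LinearMap.comp_apply]; rfl⟩⟩
  map_add' _ _ := Subtype.ext (LinearMap.ext fun _ => map_add (qFrob k K) _ _)
  map_smul' _ _ := Subtype.ext (LinearMap.ext fun _ => map_mul (qFrob k K) _ _)

theorem frobFun_apply (g : Fun F) (x : F.carrier) : (frobFun F g).1 x = qFrob k K (g.1 x) := rfl

theorem frobFun_injective : Function.Injective (frobFun F) := fun _ _ hgh =>
  Subtype.ext (LinearMap.ext fun x => (qFrob k K).injective
    (LinearMap.congr_fun (congrArg Subtype.val hgh) x))

variable (F) in
/-- The `j`-th coordinate function on `F`. -/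
def coord (j : Fin n) : Fun F := restrict F ⟨MvPolynomial.X j, Lam.X_mem j⟩

theorem coord_apply (j : Fin n) (x : F.carrier) : (coord F j).1 x = (x : Fin n → K) j :=
  MvPolynomial.eval_X j

theorem iterate_frobFun_coord (j : Fin n) (l : ℕ) :
    (frobFun F)^[l] (coord F j) =
      restrict F ⟨MvPolynomial.X j ^ (Fintype.card k ^ l), Submodule.subset_span ⟨j, l, rfl⟩⟩ := by
  induction l with
  | zero => simp [coord]
  | succ l ih =>
    rw [Function.iterate_succ_apply', ih]
    refine Subtype.ext (LinearMap.ext fun x => ?_)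
    rw [frobFun_apply, restrict_apply, restrict_apply, map_pow, qFrob_apply, ← pow_mul,
      ← pow_succ, map_pow]

variable [IsAlgClosed K]

/-- `K{F} / K{F} ^ q` embeds into the dual of the tangent space: the linear forms that vanish on
`T(F)` are the linear parts of the polynomials that vanish on `F`. -/
theorem restrict_mem_range_frobFun (u : Lam k K n)
    (hu : ∀ x ∈ tangent F, linPart u.1 x = 0) : restrict F u ∈ LinearMap.range (frobFun F) := by
  let D : Submodule K (Module.Dual K (Fin n → K)) :=
    (LinearMap.ker (restrict F)).map (linPart.comp (Lam k K n).subtype)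
  have hmem : linPart u.1 ∈ D := by
    rw [← Subspace.dualCoannihilator_dualAnnihilator_eq (W := D), Submodule.mem_dualAnnihilator]
    intro x hx
    refine hu x fun f hf => ?_
    refine (Submodule.mem_dualCoannihilator x).1 hx _ ⟨⟨f, hf.1⟩, ?_, rfl⟩
    exact Subtype.ext (LinearMap.ext fun y => hf.2 y y.2)
  obtain ⟨w, hw, hwu⟩ := hmem
  obtain ⟨v, hv, huv⟩ := Lam.exists_frob_eq_of_linPart_eq_zero (u - w).2 (by
    have : linPart w.1 = linPart u.1 := hwu
    rw [Submodule.coe_sub, map_sub, this, sub_self])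
  refine ⟨restrict F ⟨v, hv⟩, ?_⟩
  have h1 : restrict F u = restrict F (u - w) := by
    rw [map_sub, LinearMap.mem_ker.1 hw]
    exact (sub_zero _).symm
  rw [h1]
  refine Subtype.ext (LinearMap.ext fun x => ?_)
  rw [frobFun_apply, restrict_apply, restrict_apply, huv, map_pow, qFrob_apply]

end Functions

/-! ### The motive and the torsion points of a module -/

namespace AModule

variable {k K : Type*} [Field k] [Fintype k] [Field K] [Algebra k K]
  {δ : k[X] →ₐ[k] K} {n : ℕ} {F : QVariety k K n}

instance (Φ : AModule δ F) : AddCommGroup Φ.Motive := Module.AEval.instAddCommGroup _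

/-- A function on `F`, as an element of the `K[T]`-module `K{F}`. -/
abbrev toMotive (Φ : AModule δ F) : Fun F ≃ₗ[K] Φ.Motive :=
  Module.AEval'.of (pullback (Φ.toAlgHom X))

/-- The operator `g ↦ g ^ q` on the `K[T]`-module `K{F}`. -/
def frobMotive (Φ : AModule δ F) : Φ.Motive →ₛₗ[twist k K] Φ.Motive :=
  aevalFrob (σ := frobFun F) fun _ => rfl

theorem frobMotive_toMotive (Φ : AModule δ F) (g : Fun F) :
    Φ.frobMotive (Φ.toMotive g) = Φ.toMotive (frobFun F g) := rfl

theorem iterate_frobMotive_toMotive (Φ : AModule δ F) (g : Fun F) (l : ℕ) :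
    Φ.frobMotive^[l] (Φ.toMotive g) = Φ.toMotive ((frobFun F)^[l] g) := by
  induction l with
  | zero => rfl
  | succ l ih => rw [Function.iterate_succ_apply', ih, Function.iterate_succ_apply']; rfl

theorem frobMotive_injective (Φ : AModule δ F) : Function.Injective Φ.frobMotive :=
  Φ.toMotive.injective.comp (frobFun_injective.comp Φ.toMotive.symm.injective)

theorem exists_mem_iterSpan (Φ : AModule δ F) (m : Φ.Motive) :
    ∃ i, m ∈ iterSpan Φ.frobMotive (fun j => Φ.toMotive (coord F j)) i := by
  obtain ⟨g, rfl⟩ := Φ.toMotive.surjective m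
  obtain ⟨⟨f, hf⟩, rfl⟩ := restrict_surjective g
  induction hf using Submodule.span_induction with
  | mem f h =>
    obtain ⟨j, l, rfl⟩ := h
    refine ⟨l + 1, ?_⟩
    rw [← iterate_frobFun_coord, ← iterate_frobMotive_toMotive]
    exact iterate_mem_iterSpan (Nat.lt_succ_self l) j
  | zero =>
    refine ⟨0, ?_⟩
    rw [show (⟨0, zero_mem _⟩ : Lam k K n) = 0 from rfl, map_zero, map_zero]
    exact zero_mem _
  | add f g hf hg ihf ihg =>
    obtain ⟨i, hi⟩ := ihf
    obtain ⟨j, hj⟩ := ihg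
    refine ⟨max i j, ?_⟩
    rw [show (⟨f + g, add_mem hf hg⟩ : Lam k K n) = ⟨f, hf⟩ + ⟨g, hg⟩ from rfl, map_add, map_add]
    exact add_mem (iterSpan_mono (le_max_left _ _) hi) (iterSpan_mono (le_max_right _ _) hj)
  | smul c f hf ih =>
    obtain ⟨i, hi⟩ := ih
    refine ⟨i, ?_⟩
    rw [show (⟨c • f, Submodule.smul_mem _ c hf⟩ : Lam k K n) = c • ⟨f, hf⟩ from rfl, map_smul,
      map_smul]
    exact Submodule.smul_mem _ _ hi

/-- `T - δ(T)` kills the cotangent space `K{F} / K{F} ^ q`. -/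
theorem X_sub_C_smul_mem_range_frobMotive [IsAlgClosed K] (Φ : AModule δ F) (m : Φ.Motive) :
    (X - C (δ X) : K[X]) • m ∈ LinearMap.range Φ.frobMotive := by
  obtain ⟨g, rfl⟩ := Φ.toMotive.surjective m
  obtain ⟨f, rfl⟩ := restrict_surjective g
  obtain ⟨h, hh⟩ := (Φ.toAlgHom X).2
  let u : Lam k K n := ⟨MvPolynomial.bind₁ h f.1, Lam.bind_mem f.2 hh.1⟩ - δ X • f
  have hu : (X - C (δ X) : K[X]) • Φ.toMotive (restrict F f) = Φ.toMotive (restrict F u) := by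
    rw [sub_smul, Module.AEval'.X_smul_of, Module.AEval.C_smul, ← map_smul, ← map_sub]
    congr 1
    rw [map_sub, map_smul]
    congr 1
    refine Subtype.ext (LinearMap.ext fun x => ?_)
    rw [restrict_apply, eval_bind, ← funext (hh.2 x)]
    rfl
  rw [hu]
  obtain ⟨v, hv⟩ := restrict_mem_range_frobFun (F := F) u fun x hx => by
    have h1 := linPart_bind f.2 hh.1 x
    have h2 : (fun i => linPart (h i) x) = δ X • x := by
      funext i
      rw [← differential_apply (Φ.toAlgHom X) hh ⟨x, hx⟩ i, Φ.differential_eq]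
      rfl
    rw [h2, map_smul] at h1
    rw [show u.1 = MvPolynomial.bind₁ h f.1 - δ X • f.1 from rfl, map_sub, LinearMap.sub_apply, h1,
      map_smul, LinearMap.smul_apply, sub_self]
  exact ⟨Φ.toMotive v, by rw [frobMotive_toMotive, hv]⟩

/-- Evaluation at a point of `F`, as a linear form on `K{F}`. -/
def evalForm (Φ : AModule δ F) (x : F.carrier) : Φ.Motive →ₗ[K] K where
  toFun m := (Φ.toMotive.symm m).1 x
  map_add' m m' := by rw [map_add]; rfl
  map_smul' c m := by rw [map_smul]; rfl

/-- A Frobenius-compatible linear form on `K{F}` is evaluation at the vector of its values on the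
coordinate functions. -/
theorem form_toMotive_restrict (Φ : AModule δ F) {φ : Φ.Motive →ₗ[K] K}
    (hφ : ∀ m, φ (Φ.frobMotive m) = qFrob k K (φ m)) (f : Lam k K n) :
    φ (Φ.toMotive (restrict F f)) =
      MvPolynomial.eval (fun j => φ (Φ.toMotive (coord F j))) f.1 := by
  have h : (φ ∘ₗ Φ.toMotive.toLinearMap) ∘ₗ restrict F =
      (MvPolynomial.aeval fun j => φ (Φ.toMotive (coord F j))).toLinearMap ∘ₗ
        (Lam k K n).subtype := by
    refine Lam.linearMap_ext fun j l => ?_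
    simp only [LinearMap.comp_apply, LinearEquiv.coe_coe, Submodule.subtype_apply,
      AlgHom.toLinearMap_apply, map_pow, MvPolynomial.aeval_X]
    rw [← iterate_frobFun_coord, ← iterate_frobMotive_toMotive]
    induction l with
    | zero => simp
    | succ l ih => rw [Function.iterate_succ_apply', hφ, ih, qFrob_apply, ← pow_mul, pow_succ]
  rw [← MvPolynomial.coe_aeval_eq_eval]
  exact LinearMap.congr_fun h f

/-- The `a`-torsion points of `F` are the Frobenius-compatible linear forms on `K{F} / a K{F}`. -/
theorem card_Tor (Φ : AModule δ F) (a : k[X]) :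
    Nat.card (Φ.Tor a) = Nat.card {φ : Φ.Motive →ₗ[K] K //
      (∀ m, φ (Φ.frobMotive m) = qFrob k K (φ m)) ∧
        ∀ m, φ (a.map (algebraMap k K) • m) = 0} := by
  have key : ∀ (x : F.carrier) (g : Fun F), Φ.evalForm x (a.map (algebraMap k K) • Φ.toMotive g) =
      g.1 ((Φ.toAlgHom a : Module.End k F.carrier) x) := fun x g => by
    rw [map_smul_of]; rfl
  refine Nat.card_congr (Equiv.ofBijective (fun x => ⟨Φ.evalForm x.1, fun m => rfl, fun m => ?_⟩)
    ⟨fun x y hxy => ?_, ?_⟩)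
  · obtain ⟨g, rfl⟩ := Φ.toMotive.surjective m
    have hx : (Φ.toAlgHom a : Module.End k F.carrier) x.1 = 0 := x.2
    refine (key x.1 g).trans ?_
    rw [hx, map_zero]
  · refine Subtype.ext (Subtype.ext (funext fun j => ?_))
    have h1 : (coord F j).1 x.1 = (coord F j).1 y.1 :=
      LinearMap.congr_fun (congrArg Subtype.val hxy) (Φ.toMotive (coord F j))
    exact (coord_apply j _).symm.trans (h1.trans (coord_apply j _))
  · rintro ⟨φ, hφ, hφa⟩
    have hx : (fun j => φ (Φ.toMotive (coord F j))) ∈ F.carrier :=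
      mem_of_vanishing F fun f hf => by
        have h0 : restrict F ⟨f, hf.1⟩ = 0 :=
          Subtype.ext (LinearMap.ext fun x => hf.2 x x.2)
        rw [← form_toMotive_restrict Φ hφ ⟨f, hf.1⟩, h0, map_zero, map_zero]
    have hev : Φ.evalForm ⟨_, hx⟩ = φ := by
      refine LinearMap.ext fun m => ?_
      obtain ⟨g, rfl⟩ := Φ.toMotive.surjective m
      obtain ⟨f, rfl⟩ := restrict_surjective g
      rw [form_toMotive_restrict Φ hφ]
      rfl
    refine ⟨⟨(⟨_, hx⟩ : F.carrier), ?_⟩, Subtype.ext hev⟩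
    refine (mem_Tor Φ a _).2 (Subtype.ext (funext fun j => ?_))
    rw [← coord_apply, ← key, hev, hφa]
    rfl

theorem card_torsionBy_Tor (Φ : AModule δ F) {a p : k[X]} (hp : p ∣ a) :
    Nat.card (Submodule.torsionBy k[X] (Φ.Tor a) p) = Nat.card (Φ.Tor p) := by
  refine Nat.card_congr
    { toFun := fun x => ⟨x.1.1, congrArg Subtype.val x.2⟩
      invFun := fun x => ⟨⟨x.1, ?_⟩, Subtype.ext x.2⟩
      left_inv := fun x => rfl
      right_inv := fun x => rfl }
  obtain ⟨b, rfl⟩ := hp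
  have hx : p • x.1 = 0 := x.2
  rw [Tor, Submodule.mem_torsionBy_iff, mul_comm, mul_smul, hx, smul_zero]

end AModule

end QVar

theorem Polynomial.natCard_quotient_span_singleton {k : Type*} [Field k] [Fintype k] {a : k[X]}
    (ha : a ≠ 0) : Finite (k[X] ⧸ Ideal.span {a}) ∧
      Nat.card (k[X] ⧸ Ideal.span {a}) = Fintype.card k ^ a.natDegree := by
  have : Module.Finite k (k[X] ⧸ Ideal.span {a}) := (AdjoinRoot.powerBasis ha).finite
  refine ⟨Module.finite_of_finite k, ?_⟩
  rw [Module.natCard_eq_pow_finrank (K := k), finrank_quotient_span_eq_natDegree,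
    Nat.card_eq_fintype_card]

end

theorem theorem7p6 {k K : Type*} [Field k] [Fintype k] [Field K] [IsAlgClosed K] [Algebra k K]
    (δ : k[X] →ₐ[k] K) {n : ℕ} (F : QVar.QVariety k K n) (Φ : QVar.AModule δ F) :
    Module.Finite (RatFunc K) Φ.RatMotive ∧
      ∃ c : k[X], c ≠ 0 ∧ ∀ a : k[X], IsCoprime a c →
        Nonempty (Φ.Tor a ≃ₗ[k[X]] (Fin Φ.rank → k[X] ⧸ Ideal.span {a})) := by
  obtain ⟨hfin, c, hc0, hc1, hc⟩ := finite_and_exists_card_forms Φ.frobMotive_injective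
    Φ.exists_mem_iterSpan Φ.X_sub_C_smul_mem_range_frobMotive
  refine ⟨hfin, c, hc0, fun a ha => ?_⟩
  have hne : ∀ b : k[X], IsCoprime b c → b ≠ 0 := by
    rintro b hb rfl
    exact hc1 (isCoprime_zero_left.1 hb)
  have hcard : ∀ b : k[X], IsCoprime b c →
      Nat.card (Φ.Tor b) = Nat.card (k[X] ⧸ Ideal.span {b}) ^ Φ.rank := fun b hb => by
    rw [Φ.card_Tor, hc b hb, (natCard_quotient_span_singleton (hne b hb)).2]
    rfl
  have hfinite : Finite (Φ.Tor a) := by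
    have := (natCard_quotient_span_singleton (hne a ha)).1
    refine Nat.finite_of_card_ne_zero ?_
    rw [hcard a ha]
    exact pow_ne_zero _ Nat.card_pos.ne'
  refine nonempty_linearEquiv_pi_quotient (fun b hb => (natCard_quotient_span_singleton hb).1)
    (hne a ha) (fun x => Subtype.ext x.2) Φ.rank (fun p hp => ?_) (hcard a ha)
  rw [Φ.card_torsionBy_Tor hp, hcard p (ha.of_isCoprime_of_dvd_left hp)]
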